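/- Theorem 1. There is a deterministic catalytic algorithm that, given in-edge oracle access to a directed graph on the vertex set $\{0,\dots,n-1\}$ with $m$ edges and without parallel edges (loops are allowed, but need not occur), together with vertices $s,t$, decides whether there is a directed path from $s$ to $t$. It uses $O(\log n)$ bits of workspace and $\widetilde O(n^2)$ bits of catalytic tape, and runs in time $\widetilde O(n^3 m)$ (with $m$ replaced by $1$ if $m=0$). More precisely: there are a single finite program $P$ of a catalytic RAM and constants $C,d\in\mathbb N$, such that for all $n\ge 1$, all such graphs, all $s,t$ and every initial content $\tau\in\{0,1\}^{W}$ of the catalytic tape, where $W=C n^2(\lfloor\log_2 n\rfloor+1)^d$, the program halts after at most $C n^3\max(m,1)(\lfloor\log_2 n\rfloor+1)^d$ steps, accepts if and only if there is a path from $s$ to $t$, and leaves the catalytic tape with content $\tau$; and throughout the run its workspace fits into $k$ words of $w$ bits each, where $k,w$ depend only on $n$ and $kw\le C(\lfloor\log_2 n\rfloor+1)$. Here a catalytic RAM has a workspace of words, initially zero, and a tape of $W$ bits. In one step it can write a constant into a word, add, subtract, multiply or divide words, load or store a word by indirect addressing, jump if one word is less than another, read $n$, $s$ or $t$, read or write the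 bit of the catalytic tape whose index is in a given word, ask the oracle for the in-degree of a vertex $v$ or for the $i$-th in-neighbour of $v$ (in an arbitrary order that the oracle fixes; the answer is $\perp$ if there is none), or halt and accept or reject. -/

import Mathlib

namespace CatalyticRAM

/-- An instance of directed `s → t` connectivity on the vertex set `{0, …, n - 1}`, with in-edge
oracle access: for every vertex, its in-neighbours are listed without repetition in an arbitrary
order, which the oracle fixes. There are no parallel edges; loops are allowed. -/
structure Instance (n : ℕ) where
  /-- The directed graph. -/
  graph : Digraph (Fin n)
  /-- The in-neighbours of a vertex, in the order in which the oracle returns them. -/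
  inNbrs : Fin n → List (Fin n)
  inNbrs_nodup : ∀ v, (inNbrs v).Nodup
  mem_inNbrs : ∀ u v, u ∈ inNbrs v ↔ graph.Adj u v
  /-- The start vertex. -/
  s : Fin n
  /-- The target vertex. -/
  t : Fin n

namespace Instance

variable {n : ℕ}

/-- The number `m` of edges. -/
noncomputable def edgeCount (x : Instance n) : ℕ :=
  {e : Fin n × Fin n | x.graph.Adj e.1 e.2}.ncard

/-- There is a directed path from `s` to `t` (of length zero if `s = t`). -/
def Connected (x : Instance n) : Prop :=
  Relation.ReflTransGen x.graph.Adj x.s x.t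

/-- The in-degree query. A number that is not a vertex has in-degree `0`. -/
def inDegree (x : Instance n) (v : ℕ) : ℕ :=
  if h : v < n then (x.inNbrs ⟨v, h⟩).length else 0

/-- The in-neighbour query: the `i`-th in-neighbour of `v`, counting from `0`. The number `n`,
which is not a vertex, stands for the answer `⊥` (there is no such in-neighbour). -/
def inNeighbor (x : Instance n) (v i : ℕ) : ℕ :=
  if h : v < n then
    match (x.inNbrs ⟨v, h⟩)[i]? with
    | some u => u
    | none => n
  else n

end Instance

/-- The arithmetic operations on words. -/
inductive Arith
  | add | sub | mul | div

/-- Subtraction is truncated at `0`, and division rounds down (with `a / 0 = 0`). -/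
def Arith.eval : Arith → ℕ → ℕ → ℕ
  | .add, a, b => a + b
  | .sub, a, b => a - b
  | .mul, a, b => a * b
  | .div, a, b => a / b

/-- The instructions of a catalytic RAM. The arguments `d a b` are addresses of words of the
workspace, which is addressed by the natural numbers. -/
inductive Instr
  /-- `M[d] ← c` for a constant `c` -/
  | const (d c : ℕ)
  /-- `M[d] ← M[a] ∘ M[b]` for an arithmetic operation `∘` -/
  | arith (op : Arith) (d a b : ℕ)
  /-- `M[d] ← M[M[a]]` -/
  | load (d a : ℕ)
  /-- `M[M[a]] ← M[b]` -/
  | store (a b : ℕ)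
  /-- go to instruction `l` if `M[a] < M[b]` -/
  | jumpLt (a b l : ℕ)
  /-- `M[d] ← n`, the number of vertices -/
  | readN (d : ℕ)
  /-- `M[d] ← s`, the start vertex -/
  | readS (d : ℕ)
  /-- `M[d] ← t`, the target vertex -/
  | readT (d : ℕ)
  /-- `M[d] ←` the in-degree of `M[v]` -/
  | inDegree (d v : ℕ)
  /-- `M[d] ←` the `M[i]`-th in-neighbour of `M[v]` -/
  | inNeighbor (d v i : ℕ)
  /-- `M[d] ←` the bit of the catalytic tape at position `M[a]` -/
  | readBit (d a : ℕ)
  /-- write the bit `M[b] ≠ 0` to the catalytic tape at position `M[a]` -/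
  | writeBit (a b : ℕ)
  /-- halt and accept (`true`) or reject (`false`) -/
  | halt (accept : Bool)

/-- A program is a finite list of instructions, the same for inputs of all sizes. -/
abbrev Program := List Instr

/-- A configuration of a machine with `W` bits of catalytic tape. -/
structure Config (W : ℕ) where
  /-- The program counter. -/
  pc : ℕ
  /-- The words of the workspace. -/
  mem : ℕ → ℕ
  /-- The catalytic tape. -/
  tape : Fin W → Bool

namespace Config

variable {W : ℕ}

/-- The machine starts with an empty workspace and arbitrary catalytic tape `τ`. -/
def init (τ : Fin W → Bool) : Config W := ⟨0, fun _ => 0, τ⟩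

/-- Set word `d` of the workspace to `v` and go to the next instruction. -/
def setWord (c : Config W) (d v : ℕ) : Config W :=
  ⟨c.pc + 1, Function.update c.mem d v, c.tape⟩

/-- The bit at position `i` of the catalytic tape, as a number; `0` beyond its end. -/
def bit (c : Config W) (i : ℕ) : ℕ :=
  if h : i < W then (c.tape ⟨i, h⟩).toNat else 0

/-- Write a bit at position `i` of the catalytic tape (no effect beyond its end) and go to the
next instruction. -/
def setBit (c : Config W) (i : ℕ) (b : Bool) : Config W :=
  ⟨c.pc + 1, c.mem, fun j => if j.val = i then b else c.tape j⟩

/-- The configuration fits into `k` words of `w` bits each: every other word is zero. -/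
def Fits (k w : ℕ) (c : Config W) : Prop :=
  ∀ a, c.mem a < 2 ^ w ∧ (k ≤ a → c.mem a = 0)

end Config

section Semantics

variable {n W : ℕ}

/-- The effect of one instruction on input `x`. -/
def Instr.exec (x : Instance n) (c : Config W) : Instr → Config W
  | .const d v => c.setWord d v
  | .arith op d a b => c.setWord d (op.eval (c.mem a) (c.mem b))
  | .load d a => c.setWord d (c.mem (c.mem a))
  | .store a b => c.setWord (c.mem a) (c.mem b)
  | .jumpLt a b l => { c with pc := if c.mem a < c.mem b then l else c.pc + 1 }
  | .readN d => c.setWord d n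
  | .readS d => c.setWord d x.s
  | .readT d => c.setWord d x.t
  | .inDegree d v => c.setWord d (x.inDegree (c.mem v))
  | .inNeighbor d v i => c.setWord d (x.inNeighbor (c.mem v) (c.mem i))
  | .readBit d a => c.setWord d (c.bit (c.mem a))
  | .writeBit a b => c.setBit (c.mem a) (decide (c.mem b ≠ 0))
  | .halt _ => c

/-- One step of the machine. A machine without a current instruction is stuck, and has not
halted. -/
def step (P : Program) (x : Instance n) (c : Config W) : Config W :=
  match P[c.pc]? with
  | some i => i.exec x c
  | none => c

/-- The configuration after `j` steps, starting with catalytic tape `τ`. -/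
def run (P : Program) (x : Instance n) (τ : Fin W → Bool) (j : ℕ) : Config W :=
  (step P x)^[j] (Config.init τ)

/-- The machine has halted with the given answer. -/
def HaltsWith (P : Program) (c : Config W) (answer : Bool) : Prop :=
  P[c.pc]? = some (.halt answer)

end Semantics

/-- The program `P` is a catalytic algorithm for `s → t` connectivity that on graphs with `n`
vertices and `m` edges uses `S n` bits of workspace, catalytic tape of `W n` bits, and time
`T n m`: for every input and every initial catalytic tape `τ`, within `T n m` steps it halts with
the right answer and with catalytic tape `τ`, and throughout the run the workspace
fits into `k` words of `w` bits, where `k * w ≤ S n`. -/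
def DecidesConnectivity (P : Program) (S W : ℕ → ℕ) (T : ℕ → ℕ → ℕ) : Prop :=
  ∀ n : ℕ, ∃ k w : ℕ, k * w ≤ S n ∧
    ∀ (x : Instance n) (τ : Fin (W n) → Bool),
      ∃ j ≤ T n x.edgeCount, ∃ answer : Bool,
        HaltsWith P (run P x τ j) answer ∧
        (answer = true ↔ x.Connected) ∧
        (run P x τ j).tape = τ ∧
        ∀ i ≤ j, (run P x τ i).Fits k w

end CatalyticRAM

namespace CatalyticRAM

/-! The tape is read as registers of `B = regBits n` bits, holding unknown values `y` modulo `2 ^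
B`. Each vertex owns two of them, one in each half of the first `2 * n`. Pushing a half adds to
every register of the other half the registers of its in-neighbours. The source half does not
change, so subtracting the same sums undoes the push, also when there are loops. A round pushes in
both directions, and `n` rounds followed by the `n` inverse rounds restore the tape
(`halfStep_halfStep`, `iterate_roundStep`).

Propagation is linear. Incrementing both registers of `s` beforehand therefore changes the register
of `t` by a number that does not depend on `y`: the result `walkCount` of propagating the two units
over the natural numbers, taken modulo `2 ^ B`. This number is below `2 ^ B` (`walkCount_lt`) and is
positive exactly when `t` is reachable (`walkCount_pos_iff`), so the register of `t` changes if and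
only if there is a path (`probed_eq_iff`).

The workspace cannot hold a register, so the two values are compared one bit at a time: for each of
the `B` positions, propagation is run and undone once without and once with the increments, and only
two bits are kept. With `B` of order `n log n`, there are `B` comparisons of `O(n)` rounds each, and
a round costs `O(m B + n)` steps; this gives `n ^ 3 * max m 1` up to logarithmic factors.

The machine side consists of triples `Exec` that carry time and space bounds. `exec_adder`,
`exec_pushCode`, `exec_passCode` and `exec_compareCode` show that the code realises these maps on
`enc W y`. -/

/-- The part of a configuration other than the program counter. -/
abbrev State (W : ℕ) := (ℕ → ℕ) × (Fin W → Bool)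

namespace State

variable {W : ℕ}

/-- The configuration with program counter `p` and state `σ`. -/
def atPc (σ : State W) (p : ℕ) : Config W := ⟨p, σ.1, σ.2⟩

end State

/-! ### Running code fragments: a program logic with time and space bounds -/

section Framework

variable {n W : ℕ} (x : Instance n) (k w : ℕ)

/-- The effect of an instruction on the state. -/
def Instr.effect (σ : State W) (i : Instr) : State W :=
  ((i.exec x (σ.atPc 0)).mem, (i.exec x (σ.atPc 0)).tape)

/-- The instruction neither jumps nor halts, its target is one of the first `k` words, and the
value that it writes has at most `w` bits. -/
def Instr.Safe (σ : State W) : Instr → Prop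
  | .const d v => d < k ∧ v < 2 ^ w
  | .arith op d a b => d < k ∧ op.eval (σ.1 a) (σ.1 b) < 2 ^ w
  | .readN d => d < k ∧ n < 2 ^ w
  | .readS d => d < k ∧ (x.s : ℕ) < 2 ^ w
  | .readT d => d < k ∧ (x.t : ℕ) < 2 ^ w
  | .inDegree d v => d < k ∧ x.inDegree (σ.1 v) < 2 ^ w
  | .inNeighbor d v i => d < k ∧ x.inNeighbor (σ.1 v) (σ.1 i) < 2 ^ w
  | .readBit d a => d < k ∧ (σ.atPc 0).bit (σ.1 a) < 2 ^ w
  | .writeBit _ _ => True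
  | _ => False

/-- The effect of a sequence of instructions without jumps. -/
def effects : List Instr → State W → State W
  | [], σ => σ
  | i :: l, σ => effects l (i.effect x σ)

/-- All instructions of a sequence are safe when they are executed. -/
def SafeAll : List Instr → State W → Prop
  | [], _ => True
  | i :: l, σ => i.Safe x k w σ ∧ SafeAll l (i.effect x σ)

/-- A code fragment is a list of instructions that depends on its position in the program. -/
abbrev Frag := ℕ → List Instr

/-- A fragment without jumps. -/
def Frag.straight (l : List Instr) : Frag := fun _ => l

/-- Sequential composition of fragments. -/
def Frag.seq (F G : Frag) : Frag := fun p => F p ++ G (p + (F p).length)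

infixr:60 " ;; " => Frag.seq

/-- Skip `F` if `M[a] < M[b]`. -/
def Frag.unlessLt (a b : ℕ) (F : Frag) : Frag :=
  fun p => .jumpLt a b (p + 1 + (F (p + 1)).length) :: F (p + 1)

/-- Execute `F`, and again as long as `M[a] < M[b]`. -/
def Frag.repeatWhileLt (a b : ℕ) (F : Frag) : Frag := fun p => F p ++ [.jumpLt a b p]

/-- The list `l` stands in the program `P` at position `p`. -/
def Located (P : Program) (p : ℕ) (l : List Instr) : Prop :=
  ∀ i < l.length, P[p + i]? = l[i]?

/-- Wherever `F` stands in a program, it takes the state `σ` to `σ'` in at most `T` steps, and if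
`σ` fits into `k` words of `w` bits, then all states on the way do. -/
def Exec (F : Frag) (σ : State W) (T : ℕ) (σ' : State W) : Prop :=
  ∀ (P : Program) (p : ℕ), Located P p (F p) → (σ.atPc p).Fits k w →
    ∃ j ≤ T, (step P x)^[j] (σ.atPc p) = σ'.atPc (p + (F p).length) ∧
      ∀ i ≤ j, ((step P x)^[i] (σ.atPc p)).Fits k w

variable {x k w}

theorem Located.left {P : Program} {p : ℕ} {l l' : List Instr} (h : Located P p (l ++ l')) :
    Located P p l := by
  intro i hi
  rw [h i (by simp; omega), List.getElem?_append_left hi]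

theorem Located.right {P : Program} {p : ℕ} {l l' : List Instr} (h : Located P p (l ++ l')) :
    Located P (p + l.length) l' := by
  intro i hi
  rw [add_assoc, h (l.length + i) (by simp; omega), List.getElem?_append_right (by omega)]
  simp

theorem Located.head {P : Program} {p : ℕ} {i : Instr} {l : List Instr}
    (h : Located P p (i :: l)) : P[p]? = some i := by
  simpa using h 0 (by simp)

theorem Located.tail {P : Program} {p : ℕ} {i : Instr} {l : List Instr}
    (h : Located P p (i :: l)) : Located P (p + 1) l :=
  Located.right (l := [i]) h

theorem fits_setWord {c : Config W} (h : c.Fits k w) {d v : ℕ} (hd : d < k) (hv : v < 2 ^ w) :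
    (c.setWord d v).Fits k w := by
  intro a
  simp only [Config.setWord, Function.update_apply]
  split_ifs with h'
  · exact ⟨hv, by omega⟩
  · exact h a

theorem Instr.Safe.exec_eq {σ : State W} {i : Instr} (h : i.Safe x k w σ) (p : ℕ) :
    i.exec x (σ.atPc p) = (i.effect x σ).atPc (p + 1) := by
  cases i <;> first | exact h.elim | rfl

theorem Instr.Safe.fits {σ : State W} {i : Instr} (h : i.Safe x k w σ) {p : ℕ}
    (hσ : (σ.atPc p).Fits k w) : (i.exec x (σ.atPc p)).Fits k w := by
  cases i <;> first | exact h.elim | exact fits_setWord hσ h.1 h.2 | exact hσ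

theorem exec_nil (σ : State W) : Exec x k w (Frag.straight []) σ 0 σ := by
  intro P p _ hσ
  exact ⟨0, le_rfl, rfl, fun i hi => by obtain rfl := Nat.le_zero.1 hi; exact hσ⟩

theorem Exec.mono {F : Frag} {σ σ' : State W} {T T' : ℕ} (h : Exec x k w F σ T σ')
    (hT : T ≤ T') : Exec x k w F σ T' σ' := by
  intro P p hP hσ
  obtain ⟨j, hj, h⟩ := h P p hP hσ
  exact ⟨j, hj.trans hT, h⟩

theorem Exec.congr {F : Frag} {σ σ' σ'' : State W} {T : ℕ} (h : Exec x k w F σ T σ')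
    (hσ : σ' = σ'') : Exec x k w F σ T σ'' :=
  hσ ▸ h

/-- Concatenation of two runs. -/
theorem run_append {P : Program} {c c' c'' : Config W} {T T' : ℕ}
    (h : ∃ j ≤ T, (step P x)^[j] c = c' ∧ ∀ i ≤ j, ((step P x)^[i] c).Fits k w)
    (h' : c'.Fits k w → ∃ j ≤ T', (step P x)^[j] c' = c'' ∧
      ∀ i ≤ j, ((step P x)^[i] c').Fits k w) :
    ∃ j ≤ T + T', (step P x)^[j] c = c'' ∧ ∀ i ≤ j, ((step P x)^[i] c).Fits k w := by
  obtain ⟨j, hj, rfl, hf⟩ := h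
  obtain ⟨j', hj', rfl, hf'⟩ := h' (hf j le_rfl)
  refine ⟨j' + j, by omega, Function.iterate_add_apply _ _ _ _, fun i hi => ?_⟩
  rcases le_total i j with hij | hij
  · exact hf i hij
  · obtain ⟨l, rfl⟩ := Nat.exists_eq_add_of_le' hij
    rw [Function.iterate_add_apply]
    exact hf' l (by omega)

/-- A run of one step. -/
theorem run_one {P : Program} {c c' : Config W} (h : step P x c = c') (hc : c.Fits k w)
    (hc' : c'.Fits k w) :
    ∃ j ≤ 1, (step P x)^[j] c = c' ∧ ∀ i ≤ j, ((step P x)^[i] c).Fits k w := by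
  refine ⟨1, le_rfl, h, fun i hi => ?_⟩
  obtain rfl | rfl : i = 0 ∨ i = 1 := by omega
  · exact hc
  · simpa [h] using hc'

theorem step_of_getElem? {P : Program} {c : Config W} {i : Instr} (h : P[c.pc]? = some i) :
    step P x c = i.exec x c := by
  simp [step, h]

theorem Exec.seq {F G : Frag} {σ σ' σ'' : State W} {T T' : ℕ} (h : Exec x k w F σ T σ')
    (h' : Exec x k w G σ' T' σ'') : Exec x k w (F ;; G) σ (T + T') σ'' := by
  intro P p hP hσ
  have := run_append (h P p hP.left hσ) (h' P _ hP.right)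
  simpa [Frag.seq, add_assoc] using this

/-- Jump-free code is thereby reduced to two computations that `simp` and `omega` can do: a
conjunction of size bounds and an equation between states. -/
theorem exec_straight {l : List Instr} {σ σ' : State W} (h : SafeAll x k w l σ)
    (h' : effects x l σ = σ') : Exec x k w (Frag.straight l) σ l.length σ' := by
  subst h'
  induction l generalizing σ with
  | nil => exact exec_nil σ
  | cons i l ih =>
    intro P p hP hσ
    have h1 : step P x (σ.atPc p) = (i.effect x σ).atPc (p + 1) :=
      (step_of_getElem? hP.head).trans (h.1.exec_eq p)
    have h2 : ((i.effect x σ).atPc (p + 1)).Fits k w := by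
      rw [← h.1.exec_eq p]; exact h.1.fits hσ
    have := run_append (run_one h1 hσ h2) (ih h.2 P (p + 1) hP.tail)
    simpa [Frag.straight, add_assoc, add_comm 1, effects] using this

theorem exec_jumpLt_of_lt {σ : State W} {a b l p : ℕ} (h : σ.1 a < σ.1 b) :
    (Instr.jumpLt a b l).exec x (σ.atPc p) = σ.atPc l :=
  congrArg σ.atPc (if_pos h)

theorem exec_jumpLt_of_not_lt {σ : State W} {a b l p : ℕ} (h : ¬ σ.1 a < σ.1 b) :
    (Instr.jumpLt a b l).exec x (σ.atPc p) = σ.atPc (p + 1) :=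
  congrArg σ.atPc (if_neg h)

theorem Exec.unlessLt_skip {F : Frag} {σ : State W} {a b : ℕ} (h : σ.1 a < σ.1 b) :
    Exec x k w (Frag.unlessLt a b F) σ 1 σ := by
  intro P p hP hσ
  refine run_one ?_ hσ hσ
  rw [step_of_getElem? hP.head, exec_jumpLt_of_lt h, Frag.unlessLt, List.length_cons,
    Nat.add_right_comm, add_assoc]

theorem Exec.unlessLt {F : Frag} {σ σ' : State W} {a b T : ℕ} (h : ¬ σ.1 a < σ.1 b)
    (hF : Exec x k w F σ T σ') : Exec x k w (Frag.unlessLt a b F) σ (1 + T) σ' := by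
  intro P p hP hσ
  have h1 : step P x (σ.atPc p) = σ.atPc (p + 1) :=
    (step_of_getElem? hP.head).trans (exec_jumpLt_of_not_lt h)
  have := run_append (run_one h1 hσ hσ) (hF P (p + 1) hP.tail)
  simpa [Frag.unlessLt, add_assoc, add_comm 1] using this

/-- A loop whose state before the `i`-th execution of the body is `f i`, and which ends after `N`
executions. -/
theorem Exec.repeatWhileLt {F : Frag} {a b N : ℕ} (hN : 0 < N) (f : ℕ → State W) (T : ℕ → ℕ)
    (hF : ∀ i < N, Exec x k w F (f i) (T i) (f (i + 1)))
    (hlt : ∀ i < N, (f (i + 1)).1 a < (f (i + 1)).1 b ↔ i + 1 < N) :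
    Exec x k w (Frag.repeatWhileLt a b F) (f 0) (∑ i ∈ Finset.range N, (T i + 1)) (f N) := by
  intro P p hP hσ
  -- The invariant stops just before the closing jump of the last pass, because that jump is taken
  -- in all passes but the last.
  have key : ∀ m, m < N → ∃ j ≤ (∑ i ∈ Finset.range m, (T i + 1)) + T m,
      (step P x)^[j] ((f 0).atPc p) = (f (m + 1)).atPc (p + (F p).length) ∧
        ∀ i ≤ j, ((step P x)^[i] ((f 0).atPc p)).Fits k w := by
    intro m
    induction m with
    | zero =>
      intro hm
      simpa using hF 0 hm P p (Located.left hP) hσ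
    | succ m ih =>
      intro hm
      have hj : P[p + (F p).length]? = some (.jumpLt a b p) := (Located.right hP).head
      have h1 : step P x ((f (m + 1)).atPc (p + (F p).length)) = (f (m + 1)).atPc p :=
        (step_of_getElem? hj).trans (exec_jumpLt_of_lt ((hlt m (by omega)).2 hm))
      have := run_append (run_append (ih (by omega)) fun h => run_one h1 h h)
        (hF (m + 1) hm P p (Located.left hP))
      rwa [Finset.sum_range_succ, ← add_assoc]
  obtain ⟨m, rfl⟩ : ∃ m, N = m + 1 := ⟨N - 1, by omega⟩
  have hj : P[p + (F p).length]? = some (.jumpLt a b p) := (Located.right hP).head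
  have h1 : step P x ((f (m + 1)).atPc (p + (F p).length)) =
      (f (m + 1)).atPc (p + ((F p).length + 1)) :=
    (step_of_getElem? hj).trans
      (exec_jumpLt_of_not_lt (by rw [hlt m (by omega)]; omega))
  have := run_append (key m (by omega)) fun h => run_one h1 h h
  rw [Finset.sum_range_succ, ← add_assoc]
  simpa [Frag.repeatWhileLt] using this

end Framework

/-! ### Named words of the workspace -/

/-- The contents of the named words of the workspace. -/
structure Regs where
  (one two nn bb half : ℕ)
  (src dst car k a b e : ℕ)
  (v i deg u rd : ℕ)
  (j pos b0 b1 ans : ℕ)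

namespace Addr

/-- The address of the word `one`. -/
def one : ℕ := 0
/-- The address of the word `two`. -/
def two : ℕ := 1
/-- The address of the word `nn`. -/
def nn : ℕ := 2
/-- The address of the word `bb`. -/
def bb : ℕ := 3
/-- The address of the word `half`. -/
def half : ℕ := 4
/-- The address of the word `src`. -/
def src : ℕ := 5
/-- The address of the word `dst`. -/
def dst : ℕ := 6
/-- The address of the word `car`. -/
def car : ℕ := 7
/-- The address of the word `k`. -/
def k : ℕ := 8
/-- The address of the word `a`. -/
def a : ℕ := 9
/-- The address of the word `b`. -/
def b : ℕ := 10
/-- The address of the word `e`. -/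
def e : ℕ := 11
/-- The address of the word `v`. -/
def v : ℕ := 12
/-- The address of the word `i`. -/
def i : ℕ := 13
/-- The address of the word `deg`. -/
def deg : ℕ := 14
/-- The address of the word `u`. -/
def u : ℕ := 15
/-- The address of the word `rd`. -/
def rd : ℕ := 16
/-- The address of the word `j`. -/
def j : ℕ := 17
/-- The address of the word `pos`. -/
def pos : ℕ := 18
/-- The address of the word `b0`. -/
def b0 : ℕ := 19
/-- The address of the word `b1`. -/
def b1 : ℕ := 20
/-- The address of the word `ans`. -/
def ans : ℕ := 21
/-- The address of a word that is always zero. -/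
def zero : ℕ := 22

theorem lt :
    one < 32 ∧ two < 32 ∧ nn < 32 ∧ bb < 32 ∧ half < 32 ∧ src < 32 ∧ dst < 32 ∧ car < 32 ∧
    k < 32 ∧ a < 32 ∧ b < 32 ∧ e < 32 ∧ v < 32 ∧ i < 32 ∧ deg < 32 ∧ u < 32 ∧ rd < 32 ∧ j < 32 ∧
    pos < 32 ∧ b0 < 32 ∧ b1 < 32 ∧ ans < 32 := by
  decide

end Addr

namespace Regs

/-- The workspace with the given contents of the named words. -/
def toMem (r : Regs) : ℕ → ℕ
  | 0 => r.one
  | 1 => r.two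
  | 2 => r.nn
  | 3 => r.bb
  | 4 => r.half
  | 5 => r.src
  | 6 => r.dst
  | 7 => r.car
  | 8 => r.k
  | 9 => r.a
  | 10 => r.b
  | 11 => r.e
  | 12 => r.v
  | 13 => r.i
  | 14 => r.deg
  | 15 => r.u
  | 16 => r.rd
  | 17 => r.j
  | 18 => r.pos
  | 19 => r.b0
  | 20 => r.b1
  | 21 => r.ans
  | _ => 0

theorem toMem_apply (r : Regs) :
    r.toMem Addr.one = r.one ∧ r.toMem Addr.two = r.two ∧ r.toMem Addr.nn = r.nn ∧
    r.toMem Addr.bb = r.bb ∧ r.toMem Addr.half = r.half ∧ r.toMem Addr.src = r.src ∧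
    r.toMem Addr.dst = r.dst ∧ r.toMem Addr.car = r.car ∧ r.toMem Addr.k = r.k ∧
    r.toMem Addr.a = r.a ∧ r.toMem Addr.b = r.b ∧ r.toMem Addr.e = r.e ∧ r.toMem Addr.v = r.v ∧
    r.toMem Addr.i = r.i ∧ r.toMem Addr.deg = r.deg ∧ r.toMem Addr.u = r.u ∧
    r.toMem Addr.rd = r.rd ∧ r.toMem Addr.j = r.j ∧ r.toMem Addr.pos = r.pos ∧
    r.toMem Addr.b0 = r.b0 ∧ r.toMem Addr.b1 = r.b1 ∧ r.toMem Addr.ans = r.ans ∧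
    r.toMem Addr.zero = 0 := by
  refine ⟨rfl, rfl, rfl, rfl, rfl, rfl, rfl, rfl, rfl, rfl, rfl, rfl,
    rfl, rfl, rfl, rfl, rfl, rfl, rfl, rfl, rfl, rfl, rfl⟩

/-- Together with `toMem_apply`, this lets symbolic execution keep the memory in the form
`Regs.toMem`. Both are conjunctions so that one name gives `simp` all the rewrite rules. -/
theorem update_toMem (r : Regs) (x : ℕ) :
    Function.update r.toMem Addr.one x = { r with one := x }.toMem ∧
    Function.update r.toMem Addr.two x = { r with two := x }.toMem ∧
    Function.update r.toMem Addr.nn x = { r with nn := x }.toMem ∧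
    Function.update r.toMem Addr.bb x = { r with bb := x }.toMem ∧
    Function.update r.toMem Addr.half x = { r with half := x }.toMem ∧
    Function.update r.toMem Addr.src x = { r with src := x }.toMem ∧
    Function.update r.toMem Addr.dst x = { r with dst := x }.toMem ∧
    Function.update r.toMem Addr.car x = { r with car := x }.toMem ∧
    Function.update r.toMem Addr.k x = { r with k := x }.toMem ∧
    Function.update r.toMem Addr.a x = { r with a := x }.toMem ∧
    Function.update r.toMem Addr.b x = { r with b := x }.toMem ∧
    Function.update r.toMem Addr.e x = { r with e := x }.toMem ∧
    Function.update r.toMem Addr.v x = { r with v := x }.toMem ∧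
    Function.update r.toMem Addr.i x = { r with i := x }.toMem ∧
    Function.update r.toMem Addr.deg x = { r with deg := x }.toMem ∧
    Function.update r.toMem Addr.u x = { r with u := x }.toMem ∧
    Function.update r.toMem Addr.rd x = { r with rd := x }.toMem ∧
    Function.update r.toMem Addr.j x = { r with j := x }.toMem ∧
    Function.update r.toMem Addr.pos x = { r with pos := x }.toMem ∧
    Function.update r.toMem Addr.b0 x = { r with b0 := x }.toMem ∧
    Function.update r.toMem Addr.b1 x = { r with b1 := x }.toMem ∧
    Function.update r.toMem Addr.ans x = { r with ans := x }.toMem := by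
  refine ⟨?_, ?_, ?_, ?_, ?_, ?_, ?_, ?_, ?_, ?_, ?_, ?_, ?_, ?_, ?_, ?_, ?_, ?_, ?_, ?_, ?_, ?_⟩ <;>
  · funext y
    rw [Function.update_apply]
    split_ifs with h
    · subst h
      rfl
    · unfold toMem
      split <;> first | rfl | exact absurd rfl h

end Regs

section Effects

variable {n W : ℕ} (x : Instance n) (m : ℕ → ℕ) (τ : Fin W → Bool)

theorem effect_const (d v : ℕ) :
    (Instr.const d v).effect x (m, τ) = (Function.update m d v, τ) := rfl

theorem effect_arith (op : Arith) (d a b : ℕ) :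
    (Instr.arith op d a b).effect x (m, τ) = (Function.update m d (op.eval (m a) (m b)), τ) := rfl

theorem effect_readN (d : ℕ) :
    (Instr.readN d).effect x (m, τ) = (Function.update m d n, τ) := rfl

theorem effect_readS (d : ℕ) :
    (Instr.readS d).effect x (m, τ) = (Function.update m d x.s, τ) := rfl

theorem effect_readT (d : ℕ) :
    (Instr.readT d).effect x (m, τ) = (Function.update m d x.t, τ) := rfl

theorem effect_inDegree (d v : ℕ) :
    (Instr.inDegree d v).effect x (m, τ) = (Function.update m d (x.inDegree (m v)), τ) := rfl

theorem effect_inNeighbor (d v i : ℕ) :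
    (Instr.inNeighbor d v i).effect x (m, τ) =
      (Function.update m d (x.inNeighbor (m v) (m i)), τ) := rfl

theorem effect_readBit (d a : ℕ) :
    (Instr.readBit d a).effect x (m, τ) =
      (Function.update m d (Config.bit ⟨0, m, τ⟩ (m a)), τ) := rfl

theorem effect_writeBit (a b : ℕ) :
    (Instr.writeBit a b).effect x (m, τ) =
      (m, fun j => if j.val = m a then decide (m b ≠ 0) else τ j) := rfl

end Effects

/-! ### Registers on the catalytic tape -/

section Tape

variable {B W : ℕ}

/-- The catalytic tape on which, for all `i`, the bits of `y i` stand from position `i * B` on. -/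
def enc (W : ℕ) (y : ℕ → BitVec B) : Fin W → Bool :=
  fun p => (y (p / B)).getLsbD (p % B)

/-- Arbitrary tape contents become arbitrary register values, so restoring `y` is restoring the
tape. Any part of the tape past the `2 * n` registers in use is covered by further registers, which
the algorithm never changes. -/
theorem exists_enc (hB : 0 < B) (τ : Fin W → Bool) : ∃ y : ℕ → BitVec B, enc W y = τ := by
  refine ⟨fun i => BitVec.ofFnLE fun l => if h : i * B + l < W then τ ⟨_, h⟩ else false, ?_⟩
  funext p
  have hp : (p : ℕ) / B * B + p % B = p := Nat.div_add_mod' _ _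
  simp [enc, Nat.mod_lt _ hB, hp]

theorem bit_enc {y : ℕ → BitVec B} {m : ℕ → ℕ} {i l : ℕ} (hl : l < B) (hi : i * B + l < W) :
    Config.bit ⟨0, m, enc W y⟩ (i * B + l) = ((y i).getLsbD l).toNat := by
  have h1 : (i * B + l) / B = i := by
    rw [mul_comm, Nat.mul_add_div (by omega), Nat.div_eq_of_lt hl, add_zero]
  have h2 : (i * B + l) % B = l := by
    rw [Nat.mul_add_mod_self_right, Nat.mod_eq_of_lt hl]
  simp [Config.bit, hi, enc, h1, h2]

theorem enc_set {y y' : ℕ → BitVec B} {i l : ℕ} {b : Bool} (hl : l < B)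
    (hy : ∀ i' ≠ i, y' i' = y i')
    (hy' : ∀ l' < B, (y' i).getLsbD l' = if l' = l then b else (y i).getLsbD l') :
    (fun j : Fin W => if j.val = i * B + l then b else enc W y j) = enc W y' := by
  funext p
  have hp : (p : ℕ) / B * B + p % B = p := Nat.div_add_mod' _ _
  have hpB : (p : ℕ) % B < B := Nat.mod_lt _ (by omega)
  have h1 : (i * B + l) / B = i := by
    rw [mul_comm, Nat.mul_add_div (by omega), Nat.div_eq_of_lt hl, add_zero]
  have h2 : (i * B + l) % B = l := by
    rw [Nat.mul_add_mod_self_right, Nat.mod_eq_of_lt hl]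
  unfold enc
  by_cases hi : (p : ℕ) / B = i
  · rw [hi, hy' _ hpB]
    congr 1
    rw [hi] at hp
    rw [← hp]
    simp
  · rw [hy _ hi, if_neg]
    rintro h
    rw [h, h1] at hi
    exact hi rfl

end Tape

/-! ### Adding a register to another one -/

/-- The body of the loop over the bits in `adder`. -/
def adderBody (g : Bool) : List Instr :=
  [.readBit Addr.a Addr.src, .readBit Addr.b Addr.dst,
   .arith .add Addr.e Addr.a Addr.b, .arith .add Addr.e Addr.e Addr.car] ++
  (if g then [.arith .sub Addr.b Addr.one Addr.b] else []) ++
  [.arith .add Addr.b Addr.b Addr.a, .arith .add Addr.b Addr.b Addr.car,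
   .arith .div Addr.car Addr.b Addr.two,
   .arith .div Addr.b Addr.e Addr.two, .arith .add Addr.b Addr.b Addr.b,
   .arith .sub Addr.e Addr.e Addr.b, .writeBit Addr.dst Addr.e,
   .const Addr.a 0, .const Addr.b 0, .const Addr.e 0,
   .arith .add Addr.src Addr.src Addr.one, .arith .add Addr.dst Addr.dst Addr.one,
   .arith .add Addr.k Addr.k Addr.one]

/-- Add the register that starts at position `src`, and the bit `car`, to the register that starts
at position `dst`, or subtract them if `g = true`. -/
def adder (g : Bool) : Frag :=
  Frag.repeatWhileLt Addr.k Addr.bb (Frag.straight (adderBody g)) ;;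
  Frag.straight [.arith .sub Addr.src Addr.src Addr.bb, .arith .sub Addr.dst Addr.dst Addr.bb,
    .const Addr.k 0, .const Addr.car 0]

/-- The new value of a register with value `d` in `adder g`. -/
def adderVal {B : ℕ} (g : Bool) (d a : BitVec B) (c : Bool) : BitVec B :=
  if g then ~~~(~~~d + a + BitVec.setWidth B (BitVec.ofBool c))
  else d + a + BitVec.setWidth B (BitVec.ofBool c)

/-- The carry, or borrow, into position `i` in `adder g`. -/
def adderCarry {B : ℕ} (g : Bool) (d a : BitVec B) (c : Bool) (i : ℕ) : Bool :=
  BitVec.carry i (if g then ~~~d else d) a c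

/-- The value of a register with value `d` in `adder g` after `i` bits have been processed. -/
def adderPartial {B : ℕ} (g : Bool) (d a : BitVec B) (c : Bool) (i : ℕ) : BitVec B :=
  BitVec.ofFnLE fun l => if l < i then (adderVal g d a c).getLsbD l else d.getLsbD l

/-! ### Bitwise description of addition and subtraction -/

section

variable {B : ℕ} {g : Bool} {d a : BitVec B} {c : Bool} {i l : ℕ}

/-- Subtraction is `~(~d + a + c)`, and the two complements cancel in the exclusive or. Hence the
output bit has the same formula for both signs, and only the carry recursion sees the complemented
`d`. -/
theorem getLsbD_adderVal (hi : i < B) : (adderVal g d a c).getLsbD i =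
    (d.getLsbD i ^^ (a.getLsbD i ^^ adderCarry g d a c i)) := by
  cases g
  · simp only [adderVal, adderCarry, Bool.false_eq_true, if_false,
      BitVec.getLsbD_add_add_bool hi]
  · simp only [adderVal, adderCarry, if_true, BitVec.getLsbD_not,
      BitVec.getLsbD_add_add_bool hi, hi, decide_true, Bool.true_and]
    simp [hi]

theorem adderCarry_succ (hi : i < B) : adderCarry g d a c (i + 1) =
    Bool.atLeastTwo (g ^^ d.getLsbD i) (a.getLsbD i) (adderCarry g d a c i) := by
  cases g <;> simp [adderCarry, BitVec.carry_succ, hi]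

theorem getLsbD_adderPartial (hl : l < B) : (adderPartial g d a c i).getLsbD l =
    if l < i then (adderVal g d a c).getLsbD l else d.getLsbD l := by
  simp [adderPartial, hl]

theorem adderPartial_zero : adderPartial g d a c 0 = d :=
  BitVec.eq_of_getLsbD_eq fun l hl => by simp [getLsbD_adderPartial hl]

theorem adderPartial_self : adderPartial g d a c B = adderVal g d a c :=
  BitVec.eq_of_getLsbD_eq fun l hl => by rw [getLsbD_adderPartial hl, if_pos hl]

theorem setWidth_ofBool_true : BitVec.setWidth B (BitVec.ofBool true) = 1 :=
  BitVec.eq_of_toNat_eq (by simp)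

theorem adderVal_add : adderVal false d a false = d + a := by
  simp [adderVal]

theorem adderVal_add_one : adderVal false d a true = d + a + 1 := by
  rw [adderVal, setWidth_ofBool_true]
  rfl

theorem adderVal_sub : adderVal true d a false = d - a := by
  simp only [adderVal, if_true, BitVec.not_eq_neg_add, BitVec.ofBool_false,
    BitVec.ofNat_eq_ofNat]
  have : BitVec.setWidth B 0#1 = 0 := by simp
  rw [this]
  ring

theorem adderVal_sub_one : adderVal true d a true = d - a - 1 := by
  simp only [adderVal, if_true, BitVec.not_eq_neg_add, setWidth_ofBool_true]
  ring

end

/-- The values of the words that are constant during the main part of the algorithm, and the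
scratch words of `adder`, which are zero outside of it. -/
structure Regs.Ready (n B : ℕ) (r : Regs) : Prop where
  one : r.one = 1
  two : r.two = 2
  nn : r.nn = n
  bb : r.bb = B
  half : r.half = n * B
  k : r.k = 0
  a : r.a = 0
  b : r.b = 0
  e : r.e = 0

/-- The word `e` receives the sum of three bits, whose parity is the output bit, while `b` receives
the sum with the destination bit complemented if `g`, whose half is the new carry. The effect is
checked on all values of the three bits and of `g`. -/
theorem exec_adderBody {n W w B : ℕ} (x : Instance n) {g c : Bool} {y y' : ℕ → BitVec B}
    {s d i p q : ℕ} (r : Regs) (h1 : r.one = 1) (h2 : r.two = 2) (hi : i < B)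
    (hs : s * B + B ≤ W) (hd : d * B + B ≤ W) (hw : W + 8 ≤ 2 ^ w)
    (ha : r.a = 0) (hb : r.b = 0) (he : r.e = 0)
    (hp : p = s * B + i) (hq : q = d * B + i)
    (hy : ∀ i' ≠ d, y' i' = y i')
    (hy' : ∀ l < B, (y' d).getLsbD l =
      if l = i then ((y d).getLsbD i ^^ ((y s).getLsbD i ^^ c)) else (y d).getLsbD l) :
    Exec x 32 w (Frag.straight (adderBody g))
      ({ r with src := p, dst := q, k := i, car := c.toNat }.toMem, enc W y)
      20
      ({ r with
          src := p + 1, dst := q + 1, k := i + 1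
          car := (Bool.atLeastTwo (g ^^ (y d).getLsbD i) ((y s).getLsbD i) c).toNat }.toMem,
        enc W y') := by
  have hbs : ∀ m : ℕ → ℕ, Config.bit ⟨0, m, enc W y⟩ p = ((y s).getLsbD i).toNat := by
    intro m; rw [hp]; exact bit_enc hi (by omega)
  have hbd : ∀ m : ℕ → ℕ, Config.bit ⟨0, m, enc W y⟩ q = ((y d).getLsbD i).toNat := by
    intro m; rw [hq]; exact bit_enc hi (by omega)
  have hset := enc_set (W := W) (y := y) (y' := y') hi hy hy'
  rw [← hq] at hset
  refine (exec_straight (σ' := _) ?_ ?_).mono (?_ : _ ≤ 20)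
  · have : p + 8 ≤ 2 ^ w := by omega
    have : q + 8 ≤ 2 ^ w := by omega
    have : i + 8 ≤ 2 ^ w := by omega
    generalize (y s).getLsbD i = bs at *
    generalize (y d).getLsbD i = bd at *
    have : bs.toNat ≤ 1 := bs.toNat_le
    have : bd.toNat ≤ 1 := bd.toNat_le
    have : c.toNat ≤ 1 := c.toNat_le
    cases g <;>
    simp only [adderBody, SafeAll, effect_const, effect_arith, effect_readBit, effect_writeBit,
      Regs.update_toMem, Regs.toMem_apply, hbs, hbd, Instr.Safe, Addr.lt, Arith.eval,
      State.atPc, List.cons_append, List.nil_append, List.append_nil, if_true, if_false,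
      Bool.false_eq_true, h1, h2, true_and, and_true] <;>
    omega
  · rw [← hset]
    generalize (y s).getLsbD i = bs at *
    generalize (y d).getLsbD i = bd at *
    cases g <;> cases bs <;> cases bd <;> cases c <;>
    simp [adderBody, effects, effect_const, effect_arith, effect_readBit, effect_writeBit,
      Regs.update_toMem, Regs.toMem_apply, hbs, hbd, Arith.eval, ha, hb, he,
      h1, h2, Bool.atLeastTwo]
  · cases g <;> simp [adderBody]

/-- After `i` passes the destination has its low `i` bits from the result and the others from the
old value. Since `s ≠ d`, the addend stays intact while the destination is overwritten. -/
theorem exec_adder {n W w B : ℕ} (x : Instance n) (g c : Bool) (y : ℕ → BitVec B)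
    {s d : ℕ} {r : Regs} (hr : r.Ready n B) (hB : 0 < B)
    (hs : s * B + B ≤ W) (hd : d * B + B ≤ W) (hw : W + 8 ≤ 2 ^ w) (hsd : s ≠ d)
    (hrs : r.src = s * B) (hrd : r.dst = d * B) (hrc : r.car = c.toNat) :
    Exec x 32 w (adder g) (r.toMem, enc W y) (25 * B)
      ({ r with car := 0 }.toMem, enc W (Function.update y d (adderVal g (y d) (y s) c))) := by
  set f : ℕ → State W := fun i =>
    ({ r with
        src := s * B + i, dst := d * B + i, k := i
        car := (adderCarry g (y d) (y s) c i).toNat }.toMem,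
      enc W (Function.update y d (adderPartial g (y d) (y s) c i))) with hf
  have h0 : f 0 = (r.toMem, enc W y) := by
    simp only [hf, adderPartial_zero, Function.update_eq_self, adderCarry, BitVec.carry_zero,
      add_zero, ← hrs, ← hrd, ← hrc]
    rw [← hr.k]
  have hloop := Exec.repeatWhileLt (x := x) (k := 32) (w := w) (a := Addr.k) (b := Addr.bb)
    (F := Frag.straight (adderBody g)) hB f (fun _ => 20) ?_ ?_
  · rw [h0] at hloop
    refine (hloop.seq (exec_straight (σ' := _) ?_ ?_)).mono ?_
    · simp only [hf, SafeAll, effect_arith,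
        Regs.update_toMem, Regs.toMem_apply, Instr.Safe, Addr.lt, Arith.eval,
        true_and, and_true, hr.bb]
      omega
    · simp only [hf, effects, effect_const, effect_arith,
        Regs.update_toMem, Regs.toMem_apply, Arith.eval, adderPartial_self, hr.bb,
        Nat.add_sub_cancel]
      simp only [← hrs, ← hrd, ← hr.k]
    · simp only [Finset.sum_const, Finset.card_range, smul_eq_mul, List.length_cons,
        List.length_nil]
      omega
  · intro i hi
    have := exec_adderBody (W := W) (w := w) x (g := g) (c := adderCarry g (y d) (y s) c i)
      (y := Function.update y d (adderPartial g (y d) (y s) c i))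
      (y' := Function.update y d (adderPartial g (y d) (y s) c (i + 1)))
      (s := s) (d := d) r hr.one hr.two hi hs hd hw hr.a hr.b hr.e rfl rfl
      (fun i' hi' => by simp [Function.update_of_ne hi']) ?_
    · simpa [hf, adderCarry_succ hi, getLsbD_adderPartial hi, hsd, add_assoc] using this
    · intro l hl
      simp only [Function.update_self, Function.update_of_ne hsd, getLsbD_adderPartial hl,
        getLsbD_adderPartial hi, lt_irrefl, if_false]
      by_cases h : l = i
      · subst h
        simp [getLsbD_adderVal hl]
      · rw [if_neg h]
        congr 1
        simp only [eq_iff_iff]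
        omega
  · intro i hi
    simp [hf, Regs.toMem_apply, hr.bb]

/-! ### Pushing the registers along all edges -/

namespace Instance

variable {n : ℕ} (x : Instance n)

/-- The list of the in-neighbours of `v`. -/
def nbrs (v : ℕ) : List ℕ := if h : v < n then (x.inNbrs ⟨v, h⟩).map Fin.val else []

theorem inDegree_eq (v : ℕ) : x.inDegree v = (x.nbrs v).length := by
  unfold inDegree nbrs
  split_ifs <;> simp

theorem inNeighbor_eq {v i : ℕ} (hi : i < (x.nbrs v).length) :
    x.inNeighbor v i = (x.nbrs v)[i] := by
  unfold nbrs at hi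
  unfold inNeighbor
  split_ifs at hi with h
  · have : i < (x.inNbrs ⟨v, h⟩).length := by simpa using hi
    simp [nbrs, h, this]
  · simp at hi

theorem nbrs_lt {u v : ℕ} (hu : u ∈ x.nbrs v) : u < n := by
  unfold nbrs at hu
  split_ifs at hu with h
  · obtain ⟨u', _, rfl⟩ := List.mem_map.1 hu
    exact u'.2
  · simp at hu

theorem mem_nbrs {u v : Fin n} : (u : ℕ) ∈ x.nbrs v ↔ x.graph.Adj u v := by
  simp [nbrs, ← x.mem_inNbrs, Fin.val_inj]

theorem nodup_nbrs (v : ℕ) : (x.nbrs v).Nodup := by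
  unfold nbrs
  split_ifs
  · exact (x.inNbrs_nodup _).map Fin.val_injective
  · simp

theorem length_nbrs_le (v : ℕ) : (x.nbrs v).length ≤ n := by
  have := (x.nodup_nbrs v).subperm (l₂ := List.range n)
    fun u hu => List.mem_range.2 (x.nbrs_lt hu)
  simpa using this.length_le

/-- Edges are counted by their heads; lists without repetition make each length a cardinality. This
is how `m` enters the running time. -/
theorem sum_length_nbrs : ∑ v ∈ Finset.range n, (x.nbrs v).length = x.edgeCount := by
  classical
  have h1 : {e : Fin n × Fin n | x.graph.Adj e.1 e.2} =
      ((Finset.univ : Finset (Fin n × Fin n)).filter fun e => x.graph.Adj e.1 e.2) := by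
    ext; simp
  rw [edgeCount, h1, Set.ncard_coe_finset, Finset.sum_range,
    Finset.card_eq_sum_card_fiberwise (f := Prod.snd) (t := Finset.univ) (by simp)]
  refine Finset.sum_congr rfl fun v _ => ?_
  have h2 : (x.nbrs v).length = (x.inNbrs v).toFinset.card := by
    rw [List.toFinset_card_of_nodup (x.inNbrs_nodup v)]
    simp [nbrs]
  rw [h2]
  refine Finset.card_bij (fun u _ => (u, v)) ?_ ?_ ?_
  · intro u hu
    simpa [x.mem_inNbrs] using hu
  · intro u _ u' _ h
    exact (Prod.mk.inj h).1
  · rintro ⟨u, v'⟩ h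
    simp only [Finset.mem_filter, Finset.mem_univ, true_and] at h
    obtain ⟨h, rfl⟩ := h
    exact ⟨u, by simpa [x.mem_inNbrs] using h, rfl⟩

/-- The sums, over the in-neighbours `u` of `v`, of `y (s + u)`, at the indices `d + v` with
`v < N`. -/
def inflow {R : Type*} [AddCommMonoid R] (s d N : ℕ) (y : ℕ → R) : ℕ → R := fun r =>
  if d ≤ r ∧ r < d + N then ((x.nbrs (r - d)).map fun u => y (s + u)).sum else 0

end Instance

/-- `y + z`, or `y - z` if `g = true`. -/
def signed {R : Type*} [AddCommGroup R] (g : Bool) (y z : R) : R := if g then y - z else y + z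

/-- The index of the first register of the half in question. -/
def off (n : ℕ) (h : Bool) : ℕ := if h then n else 0

/-- The address of the word that holds the position of the half in question. -/
def halfAddr (h : Bool) : ℕ := if h then Addr.half else Addr.zero

/-- Process the `i`-th edge into `v`. -/
def addEdge (h g : Bool) : Frag :=
  Frag.straight [.inNeighbor Addr.u Addr.v Addr.i,
    .arith .mul Addr.src Addr.u Addr.bb, .arith .add Addr.src Addr.src (halfAddr h),
    .arith .mul Addr.dst Addr.v Addr.bb, .arith .add Addr.dst Addr.dst (halfAddr !h)] ;;
  adder g ;;
  Frag.straight [.const Addr.src 0, .const Addr.dst 0, .const Addr.u 0,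
    .arith .add Addr.i Addr.i Addr.one]

/-- Add to every register of the half `!h` the registers of its in-neighbours in the half `h`, or
subtract them if `g = true`. -/
def pushCode (h g : Bool) : Frag :=
  Frag.repeatWhileLt Addr.v Addr.nn (
    Frag.straight [.inDegree Addr.deg Addr.v] ;;
    Frag.unlessLt Addr.deg Addr.one (Frag.repeatWhileLt Addr.i Addr.deg (addEdge h g)) ;;
    Frag.straight [.const Addr.i 0, .const Addr.deg 0, .arith .add Addr.v Addr.v Addr.one]) ;;
  Frag.straight [.const Addr.v 0]

/-- In addition to `Regs.Ready`, the scratch words of `pushCode` are zero. -/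
structure Regs.Idle (n B : ℕ) (r : Regs) : Prop extends r.Ready n B where
  src : r.src = 0
  dst : r.dst = 0
  car : r.car = 0
  u : r.u = 0
  i : r.i = 0
  deg : r.deg = 0
  v : r.v = 0

theorem adderVal_false {B : ℕ} (g : Bool) (d a : BitVec B) :
    adderVal g d a false = signed g d a := by
  cases g
  · exact adderVal_add
  · exact adderVal_sub

theorem toMem_halfAddr (r : Regs) (h : Bool) :
    r.toMem (halfAddr h) = if h then r.half else 0 := by
  cases h <;> rfl

theorem off_mul (n B : ℕ) (h : Bool) : (if h then n * B else 0) = off n h * B := by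
  cases h <;> simp [off]

theorem off_le (n : ℕ) (h : Bool) : off n h ≤ n := by
  cases h <;> simp [off]

/-- The halves are disjoint, even for `u = v`: this is why loops do no harm and why a push never
alters its own sources. -/
theorem off_add_ne {n u v : ℕ} (h : Bool) (hu : u < n) (hv : v < n) :
    off n h + u ≠ off n (!h) + v := by
  cases h <;> simp [off] <;> omega

section

variable {n W w B : ℕ} (x : Instance n) (h g : Bool)

theorem add_mul_add_le {N a u : ℕ} (ha : a ≤ n) (hu : u < n) (hN : n * B + n * B ≤ N) :
    (a + u) * B + B ≤ N := by
  have h1 : a * B ≤ n * B := Nat.mul_le_mul_right _ ha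
  have h2 : (u + 1) * B ≤ n * B := Nat.mul_le_mul_right _ hu
  calc (a + u) * B + B = a * B + (u + 1) * B := by ring
    _ ≤ N := by omega

theorem exec_addEdge (hB : 0 < B) (hW : n * B + n * B ≤ W) (hnW : n ≤ W) (hw : W + 8 ≤ 2 ^ w)
    (y : ℕ → BitVec B) {r : Regs} {v i : ℕ} (hr : r.Ready n B)
    (hsrc : r.src = 0) (hdst : r.dst = 0) (hcar : r.car = 0) (hu : r.u = 0)
    (hv : v < n) (hi : i < (x.nbrs v).length) (hrv : r.v = v) :
    Exec x 32 w (addEdge h g) ({ r with i := i }.toMem, enc W y) (25 * B + 9)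
      ({ r with i := i + 1 }.toMem, enc W (Function.update y (off n (!h) + v)
        (signed g (y (off n (!h) + v)) (y (off n h + (x.nbrs v)[i]))))) := by
  have hl := x.length_nbrs_le v
  have hun : (x.nbrs v)[i] < n := x.nbrs_lt (List.getElem_mem hi)
  have hnb := x.inNeighbor_eq hi
  set u := (x.nbrs v)[i] with hu'
  have hs := add_mul_add_le (B := B) (off_le n h) hun hW
  have hd := add_mul_add_le (B := B) (off_le n (!h)) hv hW
  have hs' : u * B + off n h * B = (off n h + u) * B := by ring
  have hd' : v * B + off n (!h) * B = (off n (!h) + v) * B := by ring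
  have hsle : u * B ≤ (off n h + u) * B := Nat.mul_le_mul_right _ (by omega)
  have hdle : v * B ≤ (off n (!h) + v) * B := Nat.mul_le_mul_right _ (by omega)
  have h1 : Exec x 32 w (Frag.straight [.inNeighbor Addr.u Addr.v Addr.i,
      .arith .mul Addr.src Addr.u Addr.bb, .arith .add Addr.src Addr.src (halfAddr h),
      .arith .mul Addr.dst Addr.v Addr.bb, .arith .add Addr.dst Addr.dst (halfAddr !h)])
      ({ r with i := i }.toMem, enc W y) 5
      ({ r with i := i, u := u, src := (off n h + u) * B, dst := (off n (!h) + v) * B }.toMem,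
        enc W y) := by
    refine exec_straight ?_ ?_
    · simp only [SafeAll, effect_inNeighbor, effect_arith, Regs.update_toMem, Regs.toMem_apply,
        toMem_halfAddr, off_mul, hr.half,
        Instr.Safe, Addr.lt, Arith.eval, true_and, and_true, hrv, hnb, hr.bb, hs', hd']
      omega
    · simp only [effects, effect_inNeighbor, effect_arith, Regs.update_toMem, Regs.toMem_apply,
        toMem_halfAddr, off_mul, hr.half,
        Arith.eval, hrv, hnb, hr.bb, hs', hd']
  have h2 := exec_adder (W := W) (w := w) x g false y
    (r := { r with i := i, u := u, src := (off n h + u) * B, dst := (off n (!h) + v) * B })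
    ⟨hr.one, hr.two, hr.nn, hr.bb, hr.half, hr.k, hr.a, hr.b, hr.e⟩ hB hs hd hw
    (off_add_ne h hun hv) rfl rfl hcar
  rw [adderVal_false] at h2
  refine (h1.seq (h2.seq (exec_straight (σ' := _) ?_ ?_))).mono (?_ : _ ≤ 25 * B + 9)
  · simp only [SafeAll, effect_const, Regs.update_toMem, Regs.toMem_apply,
      Instr.Safe, Addr.lt, Arith.eval, true_and, and_true, hr.one]
    omega
  · simp only [effects, effect_const, effect_arith, Regs.update_toMem, Regs.toMem_apply,
      Arith.eval, hr.one, hsrc, hdst, hcar, hu]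
  · simp only [List.length_cons, List.length_nil]
    omega

theorem signed_zero {R : Type*} [AddCommGroup R] (g : Bool) (y : R) : signed g y 0 = y := by
  cases g <;> simp [signed]

theorem signed_signed {R : Type*} [AddCommGroup R] (g : Bool) (y z z' : R) :
    signed g (signed g y z) z' = signed g y (z + z') := by
  cases g <;> simp [signed] <;> abel

/-- The loop tests its condition only after the body, so a vertex without in-neighbours has to be
skipped by the guard. -/
theorem exec_edges (hB : 0 < B) (hW : n * B + n * B ≤ W) (hnW : n ≤ W) (hw : W + 8 ≤ 2 ^ w)
    (y : ℕ → BitVec B) {r : Regs} {v : ℕ} (hr : r.Ready n B)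
    (hsrc : r.src = 0) (hdst : r.dst = 0) (hcar : r.car = 0) (hu : r.u = 0)
    (hv : v < n) (hrv : r.v = v) (hrd : r.deg = (x.nbrs v).length) (hri : r.i = 0) :
    Exec x 32 w (Frag.unlessLt Addr.deg Addr.one
        (Frag.repeatWhileLt Addr.i Addr.deg (addEdge h g))) (r.toMem, enc W y)
      (1 + (x.nbrs v).length * (25 * B + 10))
      ({ r with i := (x.nbrs v).length }.toMem, enc W (Function.update y (off n (!h) + v)
        (signed g (y (off n (!h) + v)) ((x.nbrs v).map fun u => y (off n h + u)).sum))) := by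
  rcases Nat.eq_zero_or_pos (x.nbrs v).length with h0 | h0
  · have hnil := List.eq_nil_of_length_eq_zero h0
    simp only [hnil, List.length_nil, List.map_nil, List.sum_nil, signed_zero,
      Function.update_eq_self, ← hri]
    refine (Exec.unlessLt_skip ?_).mono (by omega)
    simp [Regs.toMem_apply, hr.one, hrd, h0]
  · refine Exec.unlessLt (by simp only [Regs.toMem_apply, hr.one, hrd]; omega) ?_
    set f : ℕ → State W := fun i =>
      ({ r with i := i }.toMem, enc W (Function.update y (off n (!h) + v)
        (signed g (y (off n (!h) + v))
          (((x.nbrs v).take i).map fun u => y (off n h + u)).sum))) with hf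
    have hloop := Exec.repeatWhileLt (x := x) (k := 32) (w := w) (a := Addr.i) (b := Addr.deg)
      (F := addEdge h g) h0 f (fun _ => 25 * B + 9) ?_ ?_
    · have hf0 : f 0 = (r.toMem, enc W y) := by
        simp only [hf, List.take_zero, List.map_nil, List.sum_nil, signed_zero,
          Function.update_eq_self]
        rw [← hri]
      rw [hf0] at hloop
      refine (hloop.mono (T' := (x.nbrs v).length * (25 * B + 10)) (by simp)).congr ?_
      simp only [hf, List.take_length]
    · intro i hi
      have hun : (x.nbrs v)[i] < n := x.nbrs_lt (List.getElem_mem hi)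
      have := exec_addEdge x h g hB hW hnW hw (Function.update y (off n (!h) + v)
        (signed g (y (off n (!h) + v))
          (((x.nbrs v).take i).map fun u => y (off n h + u)).sum)) hr hsrc hdst hcar hu hv hi hrv
      rw [Function.update_idem, Function.update_self,
        Function.update_of_ne (off_add_ne h hun hv), signed_signed] at this
      simp only [hf]
      rwa [List.take_succ_eq_append_getElem hi, List.map_append, List.sum_append,
        List.map_singleton, List.sum_singleton]
    · intro i _
      simp [hf, Regs.toMem_apply, hrd]

theorem exec_pushCode (hB : 0 < B) (hn : 0 < n) (hW : n * B + n * B ≤ W) (hw : W + 8 ≤ 2 ^ w)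
    (y : ℕ → BitVec B) {r : Regs} (hr : r.Idle n B) :
    Exec x 32 w (pushCode h g) (r.toMem, enc W y) ((25 * B + 10) * x.edgeCount + 7 * n)
      (r.toMem, enc W (signed g y (x.inflow (off n h) (off n !h) n y))) := by
  have hnW : n ≤ W := le_trans (Nat.le_mul_of_pos_right n hB) (by omega)
  set f : ℕ → State W := fun v =>
    ({ r with v := v }.toMem, enc W (signed g y (x.inflow (off n h) (off n !h) v y))) with hf
  have hloop := Exec.repeatWhileLt (x := x) (k := 32) (w := w) (a := Addr.v) (b := Addr.nn)
    (F := Frag.straight [.inDegree Addr.deg Addr.v] ;;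
      Frag.unlessLt Addr.deg Addr.one (Frag.repeatWhileLt Addr.i Addr.deg (addEdge h g)) ;;
      Frag.straight [.const Addr.i 0, .const Addr.deg 0, .arith .add Addr.v Addr.v Addr.one])
    hn f (fun v => (25 * B + 10) * (x.nbrs v).length + 5) ?_ ?_
  · have hf0 : f 0 = (r.toMem, enc W y) := by
      have : x.inflow (off n h) (off n !h) 0 y = 0 := by
        funext i
        simp [Instance.inflow]
      simp only [hf, this, signed_zero]
      rw [← hr.v]
    rw [hf0] at hloop
    refine (hloop.seq (exec_straight (σ' := _) ?_ ?_)).mono ?_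
    · simp only [SafeAll, Instr.Safe, Addr.lt, true_and, and_true]
      omega
    · simp only [hf, effects, effect_const, Regs.update_toMem]
      rw [← hr.v]
    · simp only [List.length_cons, List.length_nil, add_assoc, Finset.sum_add_distrib,
        ← Finset.mul_sum, x.sum_length_nbrs, Finset.sum_const, Finset.card_range, smul_eq_mul]
      omega
  · intro v hv
    have hl := x.length_nbrs_le v
    have h2 := exec_edges x h g hB hW hnW hw (signed g y (x.inflow (off n h) (off n !h) v y))
      (r := { r with v := v, deg := (x.nbrs v).length })
      ⟨hr.one, hr.two, hr.nn, hr.bb, hr.half, hr.k, hr.a, hr.b, hr.e⟩ hr.src hr.dst hr.car hr.u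
      hv rfl rfl hr.i
    refine ((exec_straight (σ' := ({ r with v := v, deg := (x.nbrs v).length }.toMem, _))
      ?_ ?_).seq (h2.seq (exec_straight (σ' := _) ?_ ?_))).mono (?_ : _ ≤ _)
    · simp only [hf, SafeAll, Regs.toMem_apply, Instr.Safe, Addr.lt, true_and, and_true,
        x.inDegree_eq]
      omega
    · simp only [hf, effects, effect_inDegree, Regs.update_toMem, Regs.toMem_apply,
        x.inDegree_eq]
    · simp only [SafeAll, effect_const, Regs.update_toMem, Regs.toMem_apply,
        Instr.Safe, Addr.lt, Arith.eval, true_and, and_true, hr.one]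
      omega
    · simp only [hf, effects, effect_const, effect_arith, Regs.update_toMem, Regs.toMem_apply,
        Arith.eval, hr.one, hr.i, hr.deg]
      congr 2
      have hval : ∀ i, signed g y (x.inflow (off n h) (off n !h) v y) i =
          signed g (y i) (x.inflow (off n h) (off n !h) v y i) := by
        intro i; cases g <;> rfl
      -- The vertices are processed one after another, but the summands lie in the source half and
      -- still have their original values.
      have hsame : ((x.nbrs v).map fun u =>
          signed g y (x.inflow (off n h) (off n !h) v y) (off n h + u)) =
          (x.nbrs v).map fun u => y (off n h + u) := by
        refine List.map_congr_left fun u hu => ?_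
        have hun := x.nbrs_lt hu
        rw [hval, Instance.inflow, if_neg, signed_zero]
        rintro ⟨h1, h2⟩
        exact off_add_ne (v := off n h + u - off n !h) h hun (by omega) (by omega)
      rw [hsame]
      funext i
      have hval' : signed g y (x.inflow (off n h) (off n !h) (v + 1) y) i =
          signed g (y i) (x.inflow (off n h) (off n !h) (v + 1) y i) := by
        cases g <;> rfl
      rw [hval']
      by_cases hi : i = off n (!h) + v
      · subst hi
        rw [Function.update_self, hval, signed_signed]
        simp [Instance.inflow]
      · rw [Function.update_of_ne hi, hval]
        congr 1
        unfold Instance.inflow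
        congr 1
        simp only [eq_iff_iff]
        omega
    · simp only [List.length_cons, List.length_nil]
      ring_nf
      omega
  · intro v _
    simp [hf, Regs.toMem_apply, hr.nn]

end

/-! ### Propagation along walks, and its inverse -/

section Linear

variable {n : ℕ} (x : Instance n) {R : Type*} [AddCommGroup R]

/-- The effect of `pushCode h g`. -/
def halfStep (h g : Bool) (y : ℕ → R) : ℕ → R :=
  signed g y (x.inflow (off n h) (off n !h) n y)

/-- The effect of one iteration of `passCode g`. -/
def roundStep (g : Bool) (y : ℕ → R) : ℕ → R := halfStep x (!g) g (halfStep x g g y)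

variable {x}

theorem Instance.inflow_congr {R : Type*} [AddCommMonoid R] {s d N : ℕ} {y y' : ℕ → R}
    (h : ∀ u < n, y (s + u) = y' (s + u)) : x.inflow s d N y = x.inflow s d N y' := by
  funext r
  unfold Instance.inflow
  split_ifs
  · exact congrArg List.sum (List.map_congr_left fun u hu => h u (x.nbrs_lt hu))
  · rfl

theorem Instance.inflow_off {R : Type*} [AddCommMonoid R] (h : Bool) (y : ℕ → R) {u : ℕ}
    (hu : u < n) : x.inflow (off n h) (off n !h) n y (off n h + u) = 0 := by
  rw [Instance.inflow, if_neg]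
  rintro ⟨h1, h2⟩
  exact off_add_ne (v := off n h + u - off n !h) h hu (by omega) (by omega)

theorem signed_apply (g : Bool) (y z : ℕ → R) (i : ℕ) :
    signed g y z i = signed g (y i) (z i) := by
  cases g <;> rfl

theorem signed_signed_not (g : Bool) {S : Type*} [AddCommGroup S] (y z : S) :
    signed (!g) (signed g y z) z = y := by
  cases g <;> simp [signed]

theorem signed_right_comm (g : Bool) {S : Type*} [AddCommGroup S] (y z z' : S) :
    signed g (signed g y z) z' = signed g (signed g y z') z := by
  rw [signed_signed, add_comm, ← signed_signed]

/-- The inflow depends only on the source half, which the step fixes; so the same inflow is added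
and then subtracted. -/
theorem halfStep_halfStep (h g : Bool) (y : ℕ → R) :
    halfStep x h (!g) (halfStep x h g y) = y := by
  have : x.inflow (off n h) (off n !h) n (halfStep x h g y) =
      x.inflow (off n h) (off n !h) n y := by
    refine Instance.inflow_congr fun u hu => ?_
    rw [halfStep, signed_apply, Instance.inflow_off h y hu, signed_zero]
  rw [halfStep, this, halfStep, signed_signed_not]

/-- With `g = true` the halves are pushed in the opposite order, as an inverse of a composition
requires. -/
theorem roundStep_roundStep (y : ℕ → R) : roundStep x true (roundStep x false y) = y := by
  simp only [roundStep, Bool.not_true, Bool.not_false]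
  rw [show true = !false from rfl, halfStep_halfStep, halfStep_halfStep]

theorem iterate_roundStep (m : ℕ) (y : ℕ → R) :
    (roundStep x true)^[m] ((roundStep x false)^[m] y) = y :=
  Function.LeftInverse.iterate (f := roundStep x false) roundStep_roundStep m y

end Linear

/-! ### The program -/

/-- Propagate the registers along all walks of length at most `2 * n` (`g = false`), or undo this
(`g = true`). -/
def passCode (g : Bool) : Frag :=
  Frag.repeatWhileLt Addr.rd Addr.nn (pushCode g g ;; pushCode (!g) g ;;
    Frag.straight [.arith .add Addr.rd Addr.rd Addr.one]) ;;
  Frag.straight [.const Addr.rd 0]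

/-- Increment (`g = false`) or decrement the register of `s` in the half `h`. -/
def incrCode (h g : Bool) : Frag :=
  Frag.straight [.readS Addr.src, .arith .mul Addr.src Addr.src Addr.bb,
    .arith .add Addr.dst Addr.src (halfAddr h), .arith .add Addr.src Addr.src (halfAddr !h),
    .const Addr.car 1] ;;
  adder g ;; adder (!g) ;;
  Frag.straight [.const Addr.src 0, .const Addr.dst 0]

/-- Read the bit at position `j` of the register of `t` in the first half. -/
def probeCode (d : ℕ) : Frag :=
  Frag.straight [.readT Addr.pos, .arith .mul Addr.pos Addr.pos Addr.bb,
    .arith .add Addr.pos Addr.pos Addr.j, .readBit d Addr.pos, .const Addr.pos 0]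

/-- Compare the bit at position `j` of the register of `t` after propagation, for the original
contents of the registers and after incrementing the registers of `s`. -/
def compareCode : Frag :=
  passCode false ;; probeCode Addr.b0 ;; passCode true ;;
  incrCode false false ;; incrCode true false ;;
  passCode false ;; probeCode Addr.b1 ;; passCode true ;;
  incrCode false true ;; incrCode true true ;;
  Frag.straight [.arith .sub Addr.a Addr.b0 Addr.b1, .arith .sub Addr.b Addr.b1 Addr.b0,
    .arith .add Addr.a Addr.a Addr.b, .arith .add Addr.ans Addr.ans Addr.a,
    .const Addr.a 0, .const Addr.b 0, .const Addr.b0 0, .const Addr.b1 0,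
    .arith .add Addr.j Addr.j Addr.one]

/-- Compute the constants. -/
def initCode : Frag :=
  Frag.straight [.const Addr.one 1, .const Addr.two 2, .readN Addr.nn,
    .arith .add Addr.e Addr.nn Addr.one, .const Addr.a 1] ;;
  Frag.repeatWhileLt Addr.a Addr.e (Frag.straight [.arith .add Addr.a Addr.a Addr.a,
    .arith .add Addr.b Addr.b Addr.one]) ;;
  Frag.straight [.arith .mul Addr.bb Addr.nn Addr.b, .arith .add Addr.bb Addr.bb Addr.bb,
    .arith .add Addr.bb Addr.bb Addr.bb, .arith .mul Addr.half Addr.nn Addr.bb,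
    .const Addr.a 0, .const Addr.b 0, .const Addr.e 0]

/-- The program without the final answer. -/
def mainCode : Frag := initCode ;; Frag.repeatWhileLt Addr.j Addr.bb compareCode

/-- The catalytic algorithm for connectivity. -/
def program : Program :=
  mainCode 0 ++ [.jumpLt Addr.ans Addr.one ((mainCode 0).length + 2), .halt true, .halt false]

/-- The difference between the two contents of the registers that are compared. -/
def unitAt {R : Type*} [Zero R] [One R] (n s : ℕ) : ℕ → R :=
  fun i => if i = s ∨ i = n + s then 1 else 0

/-! ### Execution of the passes and of the increments -/

section

variable {n W w B : ℕ} (x : Instance n)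

theorem exec_passCode (g : Bool) (hB : 0 < B) (hn : 0 < n) (hW : n * B + n * B ≤ W)
    (hw : W + 8 ≤ 2 ^ w) (y : ℕ → BitVec B) {r : Regs} (hr : r.Idle n B) (hrd : r.rd = 0) :
    Exec x 32 w (passCode g) (r.toMem, enc W y)
      (n * (2 * ((25 * B + 10) * x.edgeCount + 7 * n) + 2) + 1)
      (r.toMem, enc W ((roundStep x g)^[n] y)) := by
  have hnW : n ≤ W := le_trans (Nat.le_mul_of_pos_right n hB) (by omega)
  set f : ℕ → State W := fun i =>
    ({ r with rd := i }.toMem, enc W ((roundStep x g)^[i] y)) with hf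
  have hloop := Exec.repeatWhileLt (x := x) (k := 32) (w := w) (a := Addr.rd) (b := Addr.nn)
    (F := pushCode g g ;; pushCode (!g) g ;;
      Frag.straight [.arith .add Addr.rd Addr.rd Addr.one])
    hn f (fun _ => 2 * ((25 * B + 10) * x.edgeCount + 7 * n) + 1) ?_ ?_
  · have hf0 : f 0 = (r.toMem, enc W y) := by
      simp only [hf, Function.iterate_zero_apply]
      rw [← hrd]
    rw [hf0] at hloop
    refine (hloop.seq (exec_straight (σ' := _) ?_ ?_)).mono ?_
    · simp only [SafeAll, Instr.Safe, Addr.lt, true_and, and_true]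
      omega
    · simp only [hf, effects, effect_const, Regs.update_toMem]
      rw [← hrd]
    · simp
  · intro i hi
    have hr' : ({ r with rd := i } : Regs).Idle n B :=
      ⟨⟨hr.one, hr.two, hr.nn, hr.bb, hr.half, hr.k, hr.a, hr.b, hr.e⟩,
        hr.src, hr.dst, hr.car, hr.u, hr.i, hr.deg, hr.v⟩
    refine ((exec_pushCode x g g hB hn hW hw _ hr').seq
      ((exec_pushCode x (!g) g hB hn hW hw _ hr').seq
        (exec_straight (σ' := _) ?_ ?_))).mono (?_ : _ ≤ _)
    · simp only [SafeAll, Regs.toMem_apply,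
        Instr.Safe, Addr.lt, Arith.eval, true_and, and_true, hr.one]
      omega
    · simp only [hf, effects, effect_arith, Regs.update_toMem, Regs.toMem_apply,
        Arith.eval, hr.one, Function.iterate_succ_apply']
      rfl
    · simp only [List.length_cons, List.length_nil]
      omega
  · intro v _
    simp [hf, Regs.toMem_apply, hr.nn]

theorem adderVal_true {B : ℕ} (g : Bool) (d a : BitVec B) :
    adderVal g d a true = signed g (signed g d a) 1 := by
  cases g
  · exact adderVal_add_one
  · exact adderVal_sub_one

/-- The adder is reused: with initial carry `1` it adds the companion register of `s` and one, and a
second call with the opposite sign and no carry removes the companion again. -/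
theorem exec_incrCode (h g : Bool) (hB : 0 < B) (hW : n * B + n * B ≤ W)
    (hw : W + 8 ≤ 2 ^ w) (y : ℕ → BitVec B) {r : Regs} (hr : r.Idle n B) :
    Exec x 32 w (incrCode h g) (r.toMem, enc W y) (50 * B + 7)
      (r.toMem, enc W (Function.update y (off n h + x.s)
        (signed g (y (off n h + x.s)) 1))) := by
  have hs := add_mul_add_le (B := B) (off_le n !h) x.s.2 hW
  have hd := add_mul_add_le (B := B) (off_le n h) x.s.2 hW
  have hs' : (x.s : ℕ) * B + off n (!h) * B = (off n (!h) + x.s) * B := by ring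
  have hd' : (x.s : ℕ) * B + off n h * B = (off n h + x.s) * B := by ring
  have hsB : (x.s : ℕ) ≤ x.s * B := Nat.le_mul_of_pos_right _ hB
  have h1 : Exec x 32 w (Frag.straight [.readS Addr.src, .arith .mul Addr.src Addr.src Addr.bb,
      .arith .add Addr.dst Addr.src (halfAddr h), .arith .add Addr.src Addr.src (halfAddr !h),
      .const Addr.car 1]) (r.toMem, enc W y) 5
      ({ r with src := (off n (!h) + x.s) * B, dst := (off n h + x.s) * B, car := 1 }.toMem,
        enc W y) := by
    refine exec_straight ?_ ?_
    · simp only [SafeAll, effect_readS, effect_arith, Regs.update_toMem, Regs.toMem_apply,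
        toMem_halfAddr, off_mul, hr.half,
        Instr.Safe, Addr.lt, Arith.eval, true_and, and_true, hr.bb, hs', hd']
      omega
    · simp only [effects, effect_readS, effect_arith, effect_const, Regs.update_toMem,
        Regs.toMem_apply, toMem_halfAddr, off_mul, hr.half, Arith.eval, hr.bb, hs', hd']
  have hr1 : ({ r with
      src := (off n (!h) + x.s) * B, dst := (off n h + x.s) * B, car := 1 } : Regs).Ready n B :=
    ⟨hr.one, hr.two, hr.nn, hr.bb, hr.half, hr.k, hr.a, hr.b, hr.e⟩
  have hne : off n (!h) + (x.s : ℕ) ≠ off n h + x.s := (off_add_ne h x.s.2 x.s.2).symm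
  have h2 := exec_adder x g true y hr1 hB hs hd hw hne rfl rfl rfl
  have hr2 : ({ r with
      src := (off n (!h) + x.s) * B, dst := (off n h + x.s) * B, car := 0 } : Regs).Ready n B :=
    ⟨hr.one, hr.two, hr.nn, hr.bb, hr.half, hr.k, hr.a, hr.b, hr.e⟩
  have h3 := exec_adder x (!g) false (Function.update y (off n h + x.s)
    (adderVal g (y (off n h + x.s)) (y (off n (!h) + x.s)) true)) hr2 hB hs hd hw hne rfl rfl rfl
  refine (h1.seq (h2.seq (h3.seq (exec_straight (σ' := _) ?_ ?_)))).mono (?_ : _ ≤ _)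
  · simp only [SafeAll, Instr.Safe, Addr.lt, true_and, and_true]
    omega
  · have hval : adderVal (!g) (adderVal g (y (off n h + x.s)) (y (off n (!h) + x.s)) true)
        (y (off n (!h) + x.s)) false = signed g (y (off n h + x.s)) 1 := by
      rw [adderVal_false, adderVal_true, signed_right_comm, signed_signed_not]
    simp only [effects, effect_const, Regs.update_toMem, Function.update_idem,
      Function.update_self, Function.update_of_ne hne, hval]
    have hrr : { r with src := 0, dst := 0, car := 0 } = r := by
      have h1 := hr.src
      have h2 := hr.dst
      have h3 := hr.car
      cases r
      simp_all
    rw [hrr]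
  · simp only [List.length_cons, List.length_nil]
    omega

/-- The continuation `G` is part of the statement because `;;` associates to the right. -/
theorem exec_incrCode_both (g : Bool) (hB : 0 < B) (hW : n * B + n * B ≤ W)
    (hw : W + 8 ≤ 2 ^ w) (y : ℕ → BitVec B) {r : Regs} (hr : r.Idle n B) {G : Frag} {T : ℕ}
    {σ : State W} (hG : Exec x 32 w G (r.toMem, enc W (signed g y (unitAt n x.s))) T σ) :
    Exec x 32 w (incrCode false g ;; incrCode true g ;; G) (r.toMem, enc W y)
      (50 * B + 7 + (50 * B + 7 + T)) σ := by
  refine (exec_incrCode x false g hB hW hw y hr).seq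
    ((exec_incrCode x true g hB hW hw _ hr).seq ?_)
  convert hG using 3
  have hs := x.s.2
  funext i
  rw [signed_apply, unitAt]
  simp only [off, Bool.false_eq_true, if_false, if_true, zero_add, Function.update_apply]
  by_cases h1 : i = n + x.s
  · rw [if_pos h1, if_neg (by omega), if_pos (Or.inr h1), h1]
  · rw [if_neg h1]
    by_cases h2 : i = x.s
    · rw [if_pos h2, if_pos (Or.inl h2), h2]
    · rw [if_neg h2, if_neg (by tauto), signed_zero]

end

section

variable {n W w B : ℕ} (x : Instance n)

theorem safe_probe (hB : 0 < B) (hW : n * B + n * B ≤ W) (hw : W + 8 ≤ 2 ^ w)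
    (y : ℕ → BitVec B) {j : ℕ} (hj : j < B) :
    (x.t : ℕ) < 2 ^ w ∧ (x.t : ℕ) * B < 2 ^ w ∧ (x.t : ℕ) * B + j < 2 ^ w ∧
      ∀ m, Config.bit ⟨0, m, enc W y⟩ (x.t * B + j) = ((y x.t).getLsbD j).toNat := by
  have ht := add_mul_add_le (B := B) (Nat.zero_le n) x.t.2 hW
  rw [zero_add] at ht
  have htB : (x.t : ℕ) ≤ x.t * B := Nat.le_mul_of_pos_right _ hB
  exact ⟨by omega, by omega, by omega, fun m => bit_enc hj (by omega)⟩

theorem exec_probeCode_b0 (hB : 0 < B) (hW : n * B + n * B ≤ W) (hw : W + 8 ≤ 2 ^ w)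
    (y : ℕ → BitVec B) {r : Regs} {j : ℕ} (hr : r.Idle n B) (hpos : r.pos = 0) (hrj : r.j = j)
    (hj : j < B) :
    Exec x 32 w (probeCode Addr.b0) (r.toMem, enc W y) 5
      ({ r with b0 := ((y x.t).getLsbD j).toNat }.toMem, enc W y) := by
  obtain ⟨h1, h2, h3, h4⟩ := safe_probe x hB hW hw y hj
  have := Bool.toNat_le ((y x.t).getLsbD j)
  refine exec_straight ?_ ?_
  · simp only [SafeAll, effect_readT, effect_arith, Regs.update_toMem,
      Regs.toMem_apply, Instr.Safe, Addr.lt, Arith.eval, true_and, and_true, hr.bb, hrj, State.atPc,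
      h1, h2, h3, h4]
    omega
  · simp only [effects, effect_readT, effect_readBit, effect_arith, effect_const,
      Regs.update_toMem, Regs.toMem_apply, Arith.eval, hr.bb, hrj, h4, hpos]

theorem exec_probeCode_b1 (hB : 0 < B) (hW : n * B + n * B ≤ W) (hw : W + 8 ≤ 2 ^ w)
    (y : ℕ → BitVec B) {r : Regs} {j : ℕ} (hr : r.Idle n B) (hpos : r.pos = 0) (hrj : r.j = j)
    (hj : j < B) :
    Exec x 32 w (probeCode Addr.b1) (r.toMem, enc W y) 5
      ({ r with b1 := ((y x.t).getLsbD j).toNat }.toMem, enc W y) := by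
  obtain ⟨h1, h2, h3, h4⟩ := safe_probe x hB hW hw y hj
  have := Bool.toNat_le ((y x.t).getLsbD j)
  refine exec_straight ?_ ?_
  · simp only [SafeAll, effect_readT, effect_arith, Regs.update_toMem,
      Regs.toMem_apply, Instr.Safe, Addr.lt, Arith.eval, true_and, and_true, hr.bb, hrj, State.atPc,
      h1, h2, h3, h4]
    omega
  · simp only [effects, effect_readT, effect_readBit, effect_arith, effect_const,
      Regs.update_toMem, Regs.toMem_apply, Arith.eval, hr.bb, hrj, h4, hpos]

/-- The value of the register of `t` after propagation. -/
def probed (y : ℕ → BitVec B) : BitVec B := (roundStep x false)^[n] y x.t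

/-- `1` if incrementing the registers of `s` changes the bit at position `j` of `probed`. -/
def bitDiff (y : ℕ → BitVec B) (j : ℕ) : ℕ :=
  if (probed x y).getLsbD j = (probed x (y + unitAt n x.s)).getLsbD j then 0 else 1

/-- A bound for the time that `passCode` takes. -/
noncomputable def passTime (B : ℕ) : ℕ := n * (2 * ((25 * B + 10) * x.edgeCount + 7 * n) + 2) + 1

theorem exec_compareCode (hB : 0 < B) (hn : 0 < n) (hW : n * B + n * B ≤ W)
    (hw : W + 8 ≤ 2 ^ w) (y : ℕ → BitVec B) {r : Regs} {j a : ℕ} (hr : r.Idle n B)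
    (hpos : r.pos = 0) (hrd : r.rd = 0) (hb0 : r.b0 = 0) (hb1 : r.b1 = 0)
    (hj : j < B) (ha : a ≤ j) :
    Exec x 32 w compareCode ({ r with j := j, ans := a }.toMem, enc W y)
      (4 * passTime x B + 200 * B + 47)
      ({ r with j := j + 1, ans := a + bitDiff x y j }.toMem, enc W y) := by
  have hBW : B ≤ W := le_trans (Nat.le_mul_of_pos_left B hn) (by omega)
  have hr1 : ({ r with j := j, ans := a } : Regs).Idle n B :=
    ⟨⟨hr.one, hr.two, hr.nn, hr.bb, hr.half, hr.k, hr.a, hr.b, hr.e⟩,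
      hr.src, hr.dst, hr.car, hr.u, hr.i, hr.deg, hr.v⟩
  set c0 := ((probed x y).getLsbD j).toNat with hc0
  set c1 := ((probed x (y + unitAt n x.s)).getLsbD j).toNat with hc1
  have hr2 : ({ r with j := j, ans := a, b0 := c0 } : Regs).Idle n B :=
    ⟨⟨hr.one, hr.two, hr.nn, hr.bb, hr.half, hr.k, hr.a, hr.b, hr.e⟩,
      hr.src, hr.dst, hr.car, hr.u, hr.i, hr.deg, hr.v⟩
  have hr3 : ({ r with j := j, ans := a, b0 := c0, b1 := c1 } : Regs).Idle n B :=
    ⟨⟨hr.one, hr.two, hr.nn, hr.bb, hr.half, hr.k, hr.a, hr.b, hr.e⟩,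
      hr.src, hr.dst, hr.car, hr.u, hr.i, hr.deg, hr.v⟩
  have p1 := exec_passCode x false hB hn hW hw y hr1 hrd
  have p2 := exec_probeCode_b0 x hB hW hw ((roundStep x false)^[n] y) hr1 hpos rfl hj
  have p3 := exec_passCode x true hB hn hW hw ((roundStep x false)^[n] y) hr2 hrd
  rw [iterate_roundStep] at p3
  have p4 := exec_passCode x false hB hn hW hw (y + unitAt n x.s) hr2 hrd
  have p5 := exec_probeCode_b1 x hB hW hw ((roundStep x false)^[n] (y + unitAt n x.s)) hr2 hpos
    rfl hj
  have p6 := exec_passCode x true hB hn hW hw ((roundStep x false)^[n] (y + unitAt n x.s)) hr3 hrd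
  rw [iterate_roundStep] at p6
  -- With truncated subtraction this sum is the absolute difference of the two bits.
  have hdiff : c0 - c1 + (c1 - c0) = bitDiff x y j ∧ bitDiff x y j ≤ 1 ∧ c0 ≤ 1 ∧ c1 ≤ 1 := by
    rw [hc0, hc1, bitDiff]
    cases (probed x y).getLsbD j <;> cases (probed x (y + unitAt n x.s)).getLsbD j <;> simp
  obtain ⟨hd1, hd2, hd3, hd4⟩ := hdiff
  have p7 : Exec x 32 w (Frag.straight
      [.arith .sub Addr.a Addr.b0 Addr.b1, .arith .sub Addr.b Addr.b1 Addr.b0,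
      .arith .add Addr.a Addr.a Addr.b, .arith .add Addr.ans Addr.ans Addr.a,
      .const Addr.a 0, .const Addr.b 0, .const Addr.b0 0, .const Addr.b1 0,
      .arith .add Addr.j Addr.j Addr.one])
      ({ r with j := j, ans := a, b0 := c0, b1 := c1 }.toMem,
        enc W (signed true (y + unitAt n x.s) (unitAt n x.s))) 9
      ({ r with j := j + 1, ans := a + bitDiff x y j }.toMem, enc W y) := by
    refine exec_straight ?_ ?_
    · simp only [SafeAll, effect_arith, effect_const, Regs.update_toMem,
        Regs.toMem_apply, Instr.Safe, Addr.lt, Arith.eval, true_and, and_true, hr.one, hd1]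
      omega
    · have hy : signed true (y + unitAt n x.s) (unitAt n x.s) = y := by simp [signed]
      simp only [effects, effect_arith, effect_const, Regs.update_toMem, Regs.toMem_apply,
        Arith.eval, hr.one, hd1, hr.a, hr.b, hb0, hb1, hy]
  have q1 := exec_incrCode_both x true hB hW hw (y + unitAt n x.s) hr3 p7
  have q2 := exec_incrCode_both x false hB hW hw y hr2 (p4.seq (p5.seq (p6.seq q1)))
  refine (p1.seq (p2.seq (p3.seq q2))).mono ?_
  unfold passTime
  omega

/-- The workspace at the beginning of the main loop. -/
def startRegs (n B : ℕ) : Regs where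
  one := 1
  two := 2
  nn := n
  bb := B
  half := n * B
  src := 0
  dst := 0
  car := 0
  k := 0
  a := 0
  b := 0
  e := 0
  v := 0
  i := 0
  deg := 0
  u := 0
  rd := 0
  j := 0
  pos := 0
  b0 := 0
  b1 := 0
  ans := 0

theorem exec_initCode (hn : 0 < n) (hW : n * (4 * n * (Nat.log 2 n + 1)) ≤ W)
    (hw : W + 8 ≤ 2 ^ w) (τ : Fin W → Bool) :
    Exec x 32 w initCode (fun _ => 0, τ) (3 * (Nat.log 2 n + 1) + 12)
      ((startRegs n (4 * n * (Nat.log 2 n + 1))).toMem, τ) := by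
  set L := Nat.log 2 n + 1 with hL
  have hnL : n < 2 ^ L := Nat.lt_pow_succ_log_self (by norm_num) n
  have hLn : 2 ^ L ≤ 2 * n := by
    rw [hL, pow_succ, mul_comm]
    exact Nat.mul_le_mul_left 2 (Nat.pow_log_le_self 2 (by omega))
  have hLlt : L ≤ n := by
    have := Nat.log_lt_self 2 (show n ≠ 0 by omega)
    omega
  have hnW : 4 * n * L ≤ n * (4 * n * L) := Nat.le_mul_of_pos_left _ hn
  have hnL' : n ≤ n * L := Nat.le_mul_of_pos_right n (by omega)
  have e4 : 4 * n * L = 4 * (n * L) := by ring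
  have e2 : n * L + n * L + (n * L + n * L) = 4 * n * L := by ring
  -- The words `one` and `two` of `startRegs` are nonzero for all parameters, so they are reset to
  -- describe the empty workspace.
  have hzero : (fun _ => 0 : ℕ → ℕ) =
      { startRegs 0 0 with one := 0, two := 0 }.toMem := by
    funext a
    unfold Regs.toMem
    split <;> simp [startRegs]
  set f : ℕ → State W := fun i =>
    ({ startRegs n 0 with a := 2 ^ i, b := i, e := n + 1 }.toMem, τ) with hf
  have h1 : Exec x 32 w (Frag.straight [.const Addr.one 1, .const Addr.two 2, .readN Addr.nn,
      .arith .add Addr.e Addr.nn Addr.one, .const Addr.a 1]) (fun _ => 0, τ) 5 (f 0) := by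
    rw [hzero]
    refine exec_straight ?_ ?_
    · simp only [SafeAll, effect_const, effect_readN, Regs.update_toMem,
        Regs.toMem_apply, Instr.Safe, Addr.lt, Arith.eval, true_and, and_true]
      omega
    · simp [effects, effect_arith, effect_const, effect_readN, Regs.update_toMem,
        Regs.toMem_apply, Arith.eval, hf, startRegs]
  have h2 := Exec.repeatWhileLt (x := x) (k := 32) (w := w) (a := Addr.a) (b := Addr.e)
    (F := Frag.straight [.arith .add Addr.a Addr.a Addr.a, .arith .add Addr.b Addr.b Addr.one])
    (N := L) (by omega) f (fun _ => 2) ?_ ?_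
  · refine (h1.seq (h2.seq (exec_straight (σ' := _) ?_ ?_))).mono (?_ : _ ≤ _)
    · simp only [hf, SafeAll, effect_arith, Regs.update_toMem, startRegs,
        Regs.toMem_apply, Instr.Safe, Addr.lt, Arith.eval, true_and, and_true, e2]
      omega
    · simp only [hf, effects, effect_arith, effect_const, Regs.update_toMem, startRegs,
        Regs.toMem_apply, Arith.eval, e2]
    · simp only [Finset.sum_const, Finset.card_range, smul_eq_mul, List.length_cons,
        List.length_nil]
      omega
  · intro i hi
    have hi' : 2 ^ i * 2 ≤ 2 ^ L := by
      rw [← pow_succ]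
      exact Nat.pow_le_pow_right (by norm_num) hi
    refine exec_straight ?_ ?_
    · simp only [hf, SafeAll, effect_arith, Regs.update_toMem, startRegs,
        Regs.toMem_apply, Instr.Safe, Addr.lt, Arith.eval, true_and, and_true]
      omega
    · simp only [hf, effects, effect_arith, Regs.update_toMem, startRegs,
        Regs.toMem_apply, Arith.eval, pow_succ, mul_two]
  · intro i hi
    simp only [hf, Regs.toMem_apply]
    -- Doubling continues while the power is below `n + 1`, so its number of rounds is exactly
    -- `Nat.log 2 n + 1`.
    rw [Nat.lt_succ_iff, ← Nat.le_log_iff_pow_le (by norm_num) (by omega)]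
    omega

/-- The number of bits of a register. -/
def regBits (n : ℕ) : ℕ := 4 * n * (Nat.log 2 n + 1)

theorem exec_mainCode (hn : 0 < n) (hW : n * regBits n + n * regBits n ≤ W)
    (hw : W + 8 ≤ 2 ^ w) (y : ℕ → BitVec (regBits n)) :
    Exec x 32 w mainCode (fun _ => 0, enc W y)
      (3 * (Nat.log 2 n + 1) + 12 +
        regBits n * (4 * passTime x (regBits n) + 200 * regBits n + 48))
      ({ startRegs n (regBits n) with
          j := regBits n, ans := ∑ j ∈ Finset.range (regBits n), bitDiff x y j }.toMem,
        enc W y) := by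
  have hB : 0 < regBits n := by unfold regBits; positivity
  have h1 := exec_initCode x hn (W := W) (w := w) (le_trans (Nat.le_add_left _ _) hW) hw (enc W y)
  change Exec x 32 w initCode _ _ ((startRegs n (regBits n)).toMem, _) at h1
  have hr : (startRegs n (regBits n)).Idle n (regBits n) := by
    refine ⟨⟨?_, ?_, ?_, ?_, ?_, ?_, ?_, ?_, ?_⟩, ?_, ?_, ?_, ?_, ?_, ?_, ?_⟩ <;> rfl
  have h2 := Exec.repeatWhileLt (x := x) (k := 32) (w := w) (a := Addr.j) (b := Addr.bb)
    (F := compareCode) hB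
    (fun j => ({ startRegs n (regBits n) with
      j := j, ans := ∑ i ∈ Finset.range j, bitDiff x y i }.toMem, enc W y))
    (fun _ => 4 * passTime x (regBits n) + 200 * (regBits n) + 47) ?_ ?_
  · refine (h1.seq h2).mono ?_
    simp
  · intro j hj
    rw [Finset.sum_range_succ]
    refine exec_compareCode x hB hn hW hw y hr rfl rfl rfl rfl hj ?_
    calc ∑ i ∈ Finset.range j, bitDiff x y i ≤ ∑ i ∈ Finset.range j, 1 :=
          Finset.sum_le_sum fun i _ => by unfold bitDiff; split_ifs <;> simp
      _ = j := by simp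
  · intro j _
    simp [Regs.toMem_apply, startRegs]

end

/-! ### Counting walks -/

section Walks

variable {n : ℕ} (x : Instance n)

/-- `halfStep x h false`, over any additive monoid. -/
def spread {R : Type*} [AddCommMonoid R] (h : Bool) (y : ℕ → R) : ℕ → R :=
  y + x.inflow (off n h) (off n !h) n y

/-- `roundStep x false`, over any additive monoid. -/
def spreadRound {R : Type*} [AddCommMonoid R] (y : ℕ → R) : ℕ → R :=
  spread x true (spread x false y)

variable {x}

theorem roundStep_false {R : Type*} [AddCommGroup R] :
    roundStep x false = spreadRound x (R := R) := rfl

theorem spread_add {R : Type*} [AddCommMonoid R] (h : Bool) (y z : ℕ → R) :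
    spread x h (y + z) = spread x h y + spread x h z := by
  have : x.inflow (off n h) (off n !h) n (y + z) =
      x.inflow (off n h) (off n !h) n y + x.inflow (off n h) (off n !h) n z := by
    funext r
    simp only [Instance.inflow, Pi.add_apply]
    split_ifs
    · exact List.sum_map_add
    · simp
  rw [spread, this, spread, spread, add_add_add_comm]

/-- Positivity and size make sense over `ℕ`, whereas the tape computes modulo `2 ^ B`; casts commute
with propagation and connect the two. -/
theorem spread_natCast {R : Type*} [Semiring R] (h : Bool) (y : ℕ → ℕ) :
    spread x h (fun i => (y i : R)) = fun i => ((spread x h y i : ℕ) : R) := by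
  funext r
  simp only [spread, Instance.inflow, Pi.add_apply]
  split_ifs
  · simp [Nat.cast_list_sum, Function.comp_def]
  · simp

theorem iterate_spreadRound_add {R : Type*} [AddCommMonoid R] (m : ℕ) (y z : ℕ → R) :
    (spreadRound x)^[m] (y + z) = (spreadRound x)^[m] y + (spreadRound x)^[m] z := by
  induction m with
  | zero => rfl
  | succ m ih => simp only [Function.iterate_succ_apply', ih, spreadRound, spread_add]

theorem iterate_spreadRound_natCast {R : Type*} [Semiring R] (m : ℕ) (y : ℕ → ℕ) :
    (spreadRound x)^[m] (fun i => (y i : R)) = fun i => (((spreadRound x)^[m] y i : ℕ) : R) := by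
  induction m with
  | zero => rfl
  | succ m ih => simp only [Function.iterate_succ_apply', ih, spreadRound, spread_natCast]

theorem spread_le (h : Bool) {y : ℕ → ℕ} {M : ℕ} (hy : ∀ i, y i ≤ M) (i : ℕ) :
    spread x h y i ≤ M * (n + 1) := by
  have : x.inflow (off n h) (off n !h) n y i ≤ n * M := by
    unfold Instance.inflow
    split_ifs
    · refine (List.sum_le_card_nsmul _ M ?_).trans ?_
      · simp only [List.mem_map]
        rintro _ ⟨u, _, rfl⟩
        exact hy _
      · simpa using Nat.mul_le_mul_right M (x.length_nbrs_le _)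
    · exact Nat.zero_le _
  calc spread x h y i = y i + x.inflow (off n h) (off n !h) n y i := rfl
    _ ≤ M + n * M := add_le_add (hy i) this
    _ = M * (n + 1) := by ring

theorem le_spread (h : Bool) (y : ℕ → ℕ) (i : ℕ) : y i ≤ spread x h y i :=
  Nat.le_add_right _ _

theorem spread_pos (h : Bool) {y : ℕ → ℕ} {u v : Fin n} (huv : x.graph.Adj u v)
    (hu : 0 < y (off n h + u)) : 0 < spread x h y (off n (!h) + v) := by
  have hv := v.2
  have h1 : y (off n h + u) ≤ x.inflow (off n h) (off n !h) n y (off n (!h) + v) := by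
    rw [Instance.inflow, if_pos (by omega), Nat.add_sub_cancel_left]
    exact List.single_le_sum (by simp) _
      (List.mem_map.2 ⟨u, x.mem_nbrs.2 huv, rfl⟩)
  exact lt_of_lt_of_le hu (h1.trans (Nat.le_add_left _ _))

/-- All registers with a positive value belong to vertices that are reachable from `s`. -/
def SupportReachable (x : Instance n) (y : ℕ → ℕ) : Prop :=
  ∀ (h : Bool) (v : Fin n), 0 < y (off n h + v) → Relation.ReflTransGen x.graph.Adj x.s v

/-- A register that becomes positive has a positive summand, which belongs to an in-neighbour;
reachability extends along that edge. -/
theorem SupportReachable.spread {y : ℕ → ℕ} (hy : SupportReachable x y) (h : Bool) :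
    SupportReachable x (spread x h y) := by
  intro h' v hv
  rcases Nat.eq_zero_or_pos (y (off n h' + v)) with h0 | h0
  · have h1 : 0 < x.inflow (off n h) (off n !h) n y (off n h' + v) := by
      simpa [CatalyticRAM.spread, h0] using hv
    have hh : h' = !h := by
      by_contra hne
      have : h' = h := by cases h <;> cases h' <;> simp_all
      rw [this, Instance.inflow_off h y v.2] at h1
      exact lt_irrefl _ h1
    subst hh
    unfold Instance.inflow at h1
    split_ifs at h1
    · rw [Nat.add_sub_cancel_left] at h1
      obtain ⟨_, hz, hz'⟩ := List.exists_mem_ne_zero_of_sum_ne_zero h1.ne'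
      obtain ⟨u, hu, rfl⟩ := List.mem_map.1 hz
      have hun := x.nbrs_lt hu
      have huv : x.graph.Adj ⟨u, hun⟩ v := x.mem_nbrs.1 hu
      exact (hy h ⟨u, hun⟩ (Nat.pos_of_ne_zero hz')).tail huv
    · exact absurd h1 (lt_irrefl _)
  · exact hy h' v h0

/-- The numbers of walks from `s` that are counted in the registers after `m` rounds. -/
def walkCount (x : Instance n) (m : ℕ) : ℕ → ℕ := (spreadRound x)^[m] (unitAt n x.s)

theorem walkCount_succ (m : ℕ) : walkCount x (m + 1) =
    spread x true (spread x false (walkCount x m)) :=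
  Function.iterate_succ_apply' _ _ _

theorem walkCount_le (m i : ℕ) : walkCount x m i ≤ (n + 1) ^ (2 * m) := by
  induction m generalizing i with
  | zero =>
    change unitAt n x.s i ≤ _
    unfold unitAt
    split_ifs <;> simp
  | succ m ih =>
    rw [walkCount_succ]
    refine (spread_le true (spread_le false ih) i).trans (le_of_eq ?_)
    ring

/-- Each of the `2 * n` pushes multiplies the maximum by at most `n + 1`, because in-degrees are at
most `n`. This dictates the order of `regBits`; its factor `4` leaves room to spare. -/
theorem walkCount_lt (hn : 0 < n) (i : ℕ) : walkCount x n i < 2 ^ regBits n := by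
  have hnL : n + 1 ≤ 2 ^ (Nat.log 2 n + 1) := Nat.lt_pow_succ_log_self (by norm_num) n
  refine (walkCount_le n i).trans_lt ?_
  calc (n + 1) ^ (2 * n) ≤ (2 ^ (Nat.log 2 n + 1)) ^ (2 * n) := Nat.pow_le_pow_left hnL _
    _ = 2 ^ (2 * n * (Nat.log 2 n + 1)) := by rw [← pow_mul, mul_comm]
    _ < 2 ^ regBits n := by
      refine Nat.pow_lt_pow_right (by norm_num) ?_
      unfold regBits
      exact Nat.mul_lt_mul_of_pos_right (by omega) (by omega)

theorem supportReachable_walkCount (m : ℕ) : SupportReachable x (walkCount x m) := by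
  induction m with
  | zero =>
    intro h v hv
    have hs := x.s.2
    have hvn := v.2
    have : (v : ℕ) = x.s := by
      by_contra hne
      have : unitAt (R := ℕ) n x.s (off n h + v) = 0 := by
        rw [unitAt, if_neg]
        cases h <;> simp [off] <;> omega
      exact hv.ne' this
    rw [Fin.ext this]
  | succ m ih =>
    rw [walkCount_succ]
    exact (ih.spread false).spread true

/-- The vertices for which both registers are positive after `m` rounds. -/
def support (x : Instance n) (m : ℕ) : Finset (Fin n) :=
  Finset.univ.filter fun v => ∀ h, 0 < walkCount x m (off n h + v)

theorem support_mono (m : ℕ) : support x m ⊆ support x (m + 1) := by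
  intro v hv
  simp only [support, Finset.mem_filter, Finset.mem_univ, true_and] at hv ⊢
  intro h
  rw [walkCount_succ]
  exact (hv h).trans_le ((le_spread _ _ _).trans (le_spread _ _ _))

/-- An edge switches halves. Starting with units in both halves makes both registers of `v`
positive, so the parity of the length of a walk is irrelevant. -/
theorem mem_support_of_adj {m : ℕ} {u v : Fin n} (hu : u ∈ support x m)
    (huv : x.graph.Adj u v) : v ∈ support x (m + 1) := by
  simp only [support, Finset.mem_filter, Finset.mem_univ, true_and] at hu ⊢
  intro h
  rw [walkCount_succ]
  cases h
  · exact spread_pos true huv ((hu true).trans_le (le_spread _ _ _))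
  · exact (spread_pos false huv (hu false)).trans_le (le_spread _ _ _)

theorem mem_support_zero : x.s ∈ support x 0 := by
  simp only [support, Finset.mem_filter, Finset.mem_univ, true_and]
  intro h
  change 0 < unitAt n x.s _
  cases h <;> simp [unitAt, off]

theorem s_mem_support (m : ℕ) : x.s ∈ support x m := by
  induction m with
  | zero => exact mem_support_zero
  | succ m ih => exact support_mono m ih

/-- A support closed under edges contains everything reachable; otherwise the next round adds a
vertex. After `n` rounds the second alternative would need more than `n` vertices. -/
theorem support_eq_or_card (m : ℕ) :
    (∀ v, Relation.ReflTransGen x.graph.Adj x.s v → v ∈ support x m) ∨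
      m + 1 ≤ (support x m).card := by
  induction m with
  | zero => exact Or.inr (Finset.card_pos.2 ⟨_, mem_support_zero⟩)
  | succ m ih =>
    by_cases hclosed : ∀ u v, u ∈ support x m → x.graph.Adj u v → v ∈ support x m
    · left
      intro v hv
      refine support_mono m ?_
      induction hv with
      | refl => exact s_mem_support m
      | tail _ huv ih => exact hclosed _ _ ih huv
    · push Not at hclosed
      obtain ⟨u, v, hu, huv, hv⟩ := hclosed
      rcases ih with ih | ih
      · exact Or.inl fun v hv => support_mono m (ih v hv)
      · right
        have : support x m ⊂ support x (m + 1) :=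
          Finset.ssubset_iff_subset_ne.2
            ⟨support_mono m, fun h => hv (h ▸ mem_support_of_adj hu huv)⟩
        have := Finset.card_lt_card this
        omega

theorem walkCount_pos_iff : 0 < walkCount x n x.t ↔ x.Connected := by
  constructor
  · intro h
    exact supportReachable_walkCount n false x.t (by simpa [off] using h)
  · intro h
    rcases support_eq_or_card (x := x) n with h' | h'
    · have := h' _ h
      simp only [support, Finset.mem_filter, Finset.mem_univ, true_and] at this
      simpa [off] using this false
    · have := Finset.card_le_univ (support x n)
      rw [Fintype.card_fin] at this
      omega

theorem probed_eq_iff (hn : 0 < n) (y : ℕ → BitVec (regBits n)) :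
    probed x y = probed x (y + unitAt n x.s) ↔ ¬ x.Connected := by
  have h1 : (unitAt n x.s : ℕ → BitVec (regBits n)) =
      fun i => ((unitAt n x.s i : ℕ) : BitVec (regBits n)) := by
    funext i
    unfold unitAt
    split_ifs
    · exact (Nat.cast_one (R := BitVec (regBits n))).symm
    · exact (Nat.cast_zero (R := BitVec (regBits n))).symm
  have h2 : probed x (y + unitAt n x.s) =
      -- By linearity the unknown contents `y` contribute equally to both sides, and the difference
      -- is the cast of a natural number.
      probed x y + (walkCount x n x.t : BitVec (regBits n)) := by
    rw [probed, probed, roundStep_false, iterate_spreadRound_add, h1,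
      iterate_spreadRound_natCast]
    rfl
  rw [h2, left_eq_add, ← walkCount_pos_iff, Nat.pos_iff_ne_zero, not_not]
  constructor
  · intro h
    have := congrArg BitVec.toNat h
    simpa [Nat.mod_eq_of_lt (walkCount_lt hn _)] using this
  · intro h
    rw [h]
    exact Nat.cast_zero

theorem sum_bitDiff_pos_iff (hn : 0 < n) (y : ℕ → BitVec (regBits n)) :
    0 < ∑ j ∈ Finset.range (regBits n), bitDiff x y j ↔ x.Connected := by
  rw [← not_iff_not, ← probed_eq_iff hn y, Nat.pos_iff_ne_zero, not_not,
    Finset.sum_eq_zero_iff]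
  constructor
  · intro h
    refine BitVec.eq_of_getLsbD_eq fun j hj => ?_
    have := h j (Finset.mem_range.2 hj)
    unfold bitDiff at this
    split_ifs at this with h'
    exact h'
  · intro h j _
    rw [bitDiff, h, if_pos rfl]

end Walks

/-! ### Resource bounds and the final answer -/

theorem exec_time_le {n L B m M T : ℕ} (hn : 0 < n) (hL : 0 < L) (hB : B = 4 * n * L)
    (hm : m ≤ M) (hM : 1 ≤ M)
    (hT : T = n * (2 * ((25 * B + 10) * m + 7 * n) + 2) + 1) :
    3 * L + 12 + B * (4 * T + 200 * B + 48) + 1 ≤ 2 ^ 14 * (n ^ 3 * M) * L ^ 2 := by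
  have hBpos : 1 ≤ B := by rw [hB]; exact Nat.mul_pos (by omega) hL
  -- This is the order of the cost of one pass. Once `T` and `B` are bounded by multiples of `X`,
  -- the remaining comparison inside the bracket is linear.
  set X := n ^ 2 * L * M with hX
  have hnX : n ^ 2 ≤ X := by
    calc n ^ 2 = n ^ 2 * 1 * 1 := by ring
      _ ≤ X := by rw [hX]; gcongr; omega
  have hn2 : n ≤ n ^ 2 := Nat.le_self_pow (by norm_num) n
  have h1 : (25 * B + 10) * m ≤ 35 * B * M := Nat.mul_le_mul (by omega) hm
  have h2 : T ≤ 297 * X := by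
    calc T ≤ n * (2 * (35 * B * M + 7 * n) + 2) + 1 := by rw [hT]; gcongr
      _ = 280 * X + 14 * n ^ 2 + 2 * n + 1 := by rw [hX, hB]; ring
      _ ≤ 297 * X := by omega
  have h3 : B ≤ 4 * X := by
    calc B = 4 * (n * L * 1) := by rw [hB]; ring
      _ ≤ 4 * X := by rw [hX]; gcongr
  have h4 : B * (4 * T + 200 * B + 48) ≤ B * (2180 * X) := by
    refine Nat.mul_le_mul_left B ?_
    omega
  have h5 : B * (2180 * X) = 8720 * (n ^ 3 * M * L ^ 2) := by rw [hX, hB]; ring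
  have h6 : L ≤ n ^ 3 * M * L ^ 2 := by
    calc L = 1 ^ 3 * 1 * L := by ring
      _ ≤ n ^ 3 * M * L ^ 2 := by
        gcongr
        · omega
        · exact Nat.le_self_pow (by norm_num) L
  calc 3 * L + 12 + B * (4 * T + 200 * B + 48) + 1 ≤ 2 ^ 14 * (n ^ 3 * M * L ^ 2) := by omega
    _ = 2 ^ 14 * (n ^ 3 * M) * L ^ 2 := by ring

theorem program_halts {n W w : ℕ} (x : Instance n) (hn : 0 < n)
    (hW : n * regBits n + n * regBits n ≤ W) (hw : W + 8 ≤ 2 ^ w) (τ : Fin W → Bool) :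
    ∃ j ≤ 3 * (Nat.log 2 n + 1) + 12 +
        regBits n * (4 * passTime x (regBits n) + 200 * regBits n + 48) + 1,
      ∃ answer : Bool, HaltsWith program (run program x τ j) answer ∧
        (answer = true ↔ x.Connected) ∧ (run program x τ j).tape = τ ∧
        ∀ i ≤ j, (run program x τ i).Fits 32 w := by
  have hB : 0 < regBits n := by unfold regBits; positivity
  obtain ⟨y, rfl⟩ := exists_enc hB τ
  set a := ∑ j ∈ Finset.range (regBits n), bitDiff x y j with ha
  set r : Regs := { startRegs n (regBits n) with j := regBits n, ans := a } with hr
  set σ : State W := (r.toMem, enc W y) with hσ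
  obtain ⟨l, hl⟩ : ∃ l, l = (mainCode 0).length := ⟨_, rfl⟩
  have hget : ∀ i, program[l + i]? =
      ([.jumpLt Addr.ans Addr.one (l + 2), .halt true, .halt false] : List Instr)[i]? := by
    intro i
    rw [program, ← hl, List.getElem?_append_right (by omega), ← hl, Nat.add_sub_cancel_left]
  have hmain := exec_mainCode x hn hW hw y program 0
    (fun i hi => by rw [program, zero_add, List.getElem?_append_left hi])
    (fun _ => ⟨by positivity, fun _ => rfl⟩)
  rw [← hl] at hmain
  -- The final jump goes to the rejecting instruction exactly when no bit differed.
  have hjump : step program x (σ.atPc (0 + l)) =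
      σ.atPc (if 0 < a then l + 1 else l + 2) := by
    have h0 : program[l]? = some (.jumpLt Addr.ans Addr.one (l + 2)) := by simpa using hget 0
    rw [zero_add, step_of_getElem? (c := σ.atPc l) h0]
    split_ifs with h
    · exact exec_jumpLt_of_not_lt (by simp only [hσ, hr, Regs.toMem_apply, startRegs]; omega)
    · exact exec_jumpLt_of_lt (by simp only [hσ, hr, Regs.toMem_apply, startRegs]; omega)
  obtain ⟨j, hj, hrun, hfits⟩ := run_append hmain fun h => run_one hjump h h
  have hrun' : run program x (enc W y) j = σ.atPc (if 0 < a then l + 1 else l + 2) := hrun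
  refine ⟨j, hj, decide (0 < a), ?_, ?_, ?_, hfits⟩
  · rw [hrun']
    unfold HaltsWith State.atPc
    split_ifs with h
    · simpa [h] using hget 1
    · simpa [h] using hget 2
  · rw [decide_eq_true_iff, ha, sum_bitDiff_pos_iff hn y]
  · rw [hrun']
    rfl

theorem decidesConnectivity_program : DecidesConnectivity program
    (fun n => 2 ^ 14 * (Nat.log 2 n + 1))
    (fun n => 2 ^ 14 * n ^ 2 * (Nat.log 2 n + 1) ^ 2)
    (fun n m => 2 ^ 14 * (n ^ 3 * max m 1) * (Nat.log 2 n + 1) ^ 2) := by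
  -- All named addresses are below `32`. A word must hold tape positions and a small margin; since
  -- `n` and `L` are below `2 ^ L`, the tape has at most `2 ^ (4 * L + 14)` bits.
  refine fun n => ⟨32, 4 * (Nat.log 2 n + 1) + 18, ?_, ?_⟩
  · change 32 * (4 * (Nat.log 2 n + 1) + 18) ≤ 2 ^ 14 * (Nat.log 2 n + 1)
    omega
  intro x τ
  -- For `n = 0` there are no instances, since `s` must be a vertex.
  have hn : 0 < n := x.s.pos
  set L := Nat.log 2 n + 1 with hL
  have hnL : n < 2 ^ L := Nat.lt_pow_succ_log_self (by norm_num) n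
  have hLL : L < 2 ^ L := Nat.lt_two_pow_self
  have hregs : regBits n = 4 * n * L := rfl
  have hW : n * regBits n + n * regBits n ≤ 2 ^ 14 * n ^ 2 * L ^ 2 := by
    calc n * regBits n + n * regBits n = 8 * n ^ 2 * L := by rw [hregs]; ring
      _ ≤ 2 ^ 14 * n ^ 2 * L ^ 2 := by
        gcongr
        · norm_num
        · exact Nat.le_self_pow (by norm_num) L
  have hw : 2 ^ 14 * n ^ 2 * L ^ 2 + 8 ≤ 2 ^ (4 * L + 18) := by
    have h1 : 2 ^ 14 * n ^ 2 * L ^ 2 ≤ 2 ^ 14 * (2 ^ L) ^ 2 * (2 ^ L) ^ 2 := by gcongr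
    have h2 : 2 ^ 14 * (2 ^ L) ^ 2 * (2 ^ L) ^ 2 = 2 ^ 14 * 2 ^ (4 * L) := by ring
    have h3 : 2 ^ (4 * L + 18) = 16 * (2 ^ 14 * 2 ^ (4 * L)) := by ring
    have h4 : 0 < 2 ^ (4 * L) := by positivity
    omega
  obtain ⟨j, hj, h⟩ := program_halts x hn hW hw τ
  exact ⟨j, hj.trans (exec_time_le hn (by omega) hregs (le_max_left _ _) (le_max_right _ _) rfl),
    h⟩

end CatalyticRAM

theorem theorem1 :
    ∃ (P : CatalyticRAM.Program) (C d : ℕ),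
      CatalyticRAM.DecidesConnectivity P
        (fun n => C * (Nat.log 2 n + 1))
        (fun n => C * n ^ 2 * (Nat.log 2 n + 1) ^ d)
        (fun n m => C * (n ^ 3 * max m 1) * (Nat.log 2 n + 1) ^ d) :=
  ⟨_, _, _, CatalyticRAM.decidesConnectivity_program⟩
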